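/- **Setting.** Let $n\ge 1$ be an integer, $0<b<\min\{2,n\}$ and $\gamma\in\{1,-1\}$. Let $\alpha_0$ be the positive root of $n x^2+(n-2+2b)x-4+2b=0$, and let $\alpha>\alpha_0$, with moreover $\alpha<\frac{4-2b}{n-2}$ if $n\ge 3$. Put $$r=\frac{n(\alpha+2)}{n-b},\qquad \frac1r+\frac1{r'}=1,\qquad \beta=\frac{4-2b-\alpha(n-2)}{2\alpha(\alpha+2)},$$ and let $r<q\le\infty$. For measurable $f:\mathbb R^n\to\mathbb C$ let $f^*(t)=\inf\{\lambda>0: |\{|f|>\lambda\}|\le t\}$ and $$\|f\|_{L^{r,q}}=\Big(\frac qr\int_0^\infty\big[t^{1/r}f^*(t)\big]^q\frac{dt}{t}\Big)^{1/q}\ (q<\infty),\qquad \|f\|_{L^{r,\infty}}=\sup_{t>0}t^{1/r}f^*(t).$$ For a tempered distribution $T$, $\|T\|_{L^{r,q}}$ is the norm of the function representing $T$, and $+\infty$ if $T$ is not given by a function. Let $e^{it\Delta}$ be the linear Schrödinger group on tempered distributions, and $B(\mu,\nu)=\int_0^1(1-s)^{\mu-1}s^{\nu-1}\,ds$. For a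 tempered distribution $\phi$, a *global solution with initial datum $\phi$* is a family $u(t)$, $t>0$, of measurable functions on $\mathbb R^n$ such that $u(t)$ and $|x|^{-b}|u(t)|^\alpha u(t)$ define tempered distributions for all $t>0$ and $$u(t)=e^{it\Delta}\phi+i\gamma\int_0^t e^{i(t-\tau)\Delta}\big(|x|^{-b}|u|^\alpha u\big)(\tau)\,d\tau\qquad\text{for all } t>0$$ as an identity of tempered distributions, the integral being absolutely convergent when tested against any Schwartz function. **Theorem 1.5 (Asymptotic stability).** There is a constant $\delta>0$, depending only on $n,b,\alpha,q$, such that the following holds for all $h$ with $0\le h<1-\beta(\alpha+1)$ and all $M>0$ with $$(2M)^\alpha\, B\Big(1-\frac n2\Big(\frac1{r'}-\frac1r\Big),\,1-\beta(\alpha+1)-h\Big)\le\delta .$$ Let $\phi,\varphi$ be tempered distributions with $$\lim_{t\to+\infty}t^{\beta+h}\|e^{it\Delta}(\phi-\varphi)\|_{L^{r,q}}=0,$$ and let $u,v$ be global solutions with initial data $\phi,\varphi$, respectively, satisfying $$\sup_{t>0}t^\beta\|u(t)\|_{L^{r,q}}\le M,\qquad \sup_{t>0}t^\beta\|v(t)\|_{L^{r,q}}\le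 M .$$ Then $$\lim_{t\to+\infty}t^{\beta+h}\|u(t)-v(t)\|_{L^{r,q}}=0 .$$ -/

import Mathlib

open MeasureTheory Filter Set
open scoped SchwartzMap Topology ENNReal NNReal

noncomputable section

namespace INLS

/-- The Euclidean space `ℝⁿ`. -/
abbrev Space (n : ℕ) : Type := EuclideanSpace ℝ (Fin n)

/-! ### Lorentz spaces -/

/-- The distribution function `d_f(lam) = |{x : |f x| > lam}|`. -/
def distribFun {n : ℕ} (f : Space n → ℂ) (lam : ℝ≥0) : ℝ≥0∞ :=
  volume {x | lam < ‖f x‖₊}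

/-- The decreasing rearrangement `f*(t) = inf {lam > 0 : d_f(lam) ≤ t}`, with `inf ∅ = ∞`. -/
def rearrangement {n : ℕ} (f : Space n → ℂ) (t : ℝ) : ℝ≥0∞ :=
  ⨅ (lam : ℝ≥0) (_ : 0 < lam) (_ : distribFun f lam ≤ ENNReal.ofReal t), (lam : ℝ≥0∞)

/-- The Lorentz (quasi-)norm `‖f‖_{L^{p,q}}`, with `0 < p < ∞` and `0 < q ≤ ∞`, as an element
of `[0, ∞]`. -/
def lorentzNorm {n : ℕ} (p : ℝ) (q : ℝ≥0∞) (f : Space n → ℂ) : ℝ≥0∞ :=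
  if q = ∞ then
    ⨆ (t : ℝ) (_ : 0 < t), ENNReal.ofReal (t ^ (1 / p)) * rearrangement f t
  else
    (ENNReal.ofReal (q.toReal / p) *
      ∫⁻ t in Ioi (0 : ℝ),
        (ENNReal.ofReal (t ^ (1 / p)) * rearrangement f t) ^ q.toReal * ENNReal.ofReal (1 / t))
      ^ (1 / q.toReal)

/-! ### Tempered distributions and the free Schrödinger group -/

/-- The tempered distribution `T` is given by the (measurable) function `f`. -/
def Represents {n : ℕ} (T : 𝓢'(Space n, ℂ)) (f : Space n → ℂ) : Prop :=
  AEStronglyMeasurable f volume ∧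
    ∀ ψ : 𝓢(Space n, ℂ), Integrable (fun x => f x * ψ x) ∧ T ψ = ∫ x, f x * ψ x

/-- The Lorentz norm of a tempered distribution: the norm of the function that represents it
(such a function is unique up to null sets), and `∞` if there is no such function. -/
def lorentzNormDist {n : ℕ} (p : ℝ) (q : ℝ≥0∞) (T : 𝓢'(Space n, ℂ)) : ℝ≥0∞ :=
  ⨅ (f : Space n → ℂ) (_ : Represents T f), lorentzNorm p q f

/-- The Fourier symbol of `e^{itΔ}`. With the Fourier transform normalised by the kernel
`e^{-2πi⟨x,ξ⟩}`, the symbol of `Δ` is `-4π²|ξ|²`. -/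
def schrodingerSymbol (n : ℕ) (t : ℝ) (ξ : Space n) : ℂ :=
  Complex.exp (((-(4 * Real.pi ^ 2 * t * ‖ξ‖ ^ 2) : ℝ) : ℂ) * Complex.I)

/-- The symbol is smooth with derivatives of polynomial growth, so that multiplication by it is
defined on Schwartz functions and on tempered distributions. -/
theorem schrodingerSymbol_hasTemperateGrowth (n : ℕ) (t : ℝ) :
    (schrodingerSymbol n t).HasTemperateGrowth := by
  have key : ∀ k : ℕ, iteratedDeriv k (fun s : ℝ => Complex.exp ((s : ℂ) * Complex.I))
      = fun s : ℝ => Complex.I ^ k * Complex.exp ((s : ℂ) * Complex.I) := by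
    intro k
    induction k with
    | zero => simp
    | succ k ih =>
      rw [iteratedDeriv_succ, ih]
      funext s
      have h1 : HasDerivAt (fun s : ℝ => (s : ℂ) * Complex.I) (1 * Complex.I) s :=
        (Complex.ofRealCLM.hasDerivAt (x := s)).mul_const Complex.I
      have h2 := (h1.cexp.const_mul (Complex.I ^ k)).deriv
      rw [h2]
      ring
  have hexp : Function.HasTemperateGrowth
      (fun s : ℝ => Complex.exp ((s : ℂ) * Complex.I)) := by
    refine ⟨?_, fun k => ⟨0, 1, fun s => ?_⟩⟩
    · exact Complex.contDiff_exp.comp (Complex.ofRealCLM.contDiff.mul contDiff_const)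
    · rw [norm_iteratedFDeriv_eq_norm_iteratedDeriv, key]
      simp [Complex.norm_exp_ofReal_mul_I]
  have hf : Function.HasTemperateGrowth
      (fun ξ : Space n => -(4 * Real.pi ^ 2 * t * ‖ξ‖ ^ 2)) := by
    fun_prop
  exact hexp.comp hf

/-- The linear Schrödinger group `e^{itΔ}` on tempered distributions. -/
def schrodingerGroup {n : ℕ} (t : ℝ) : 𝓢'(Space n, ℂ) →L[ℂ] 𝓢'(Space n, ℂ) :=
  TemperedDistribution.fourierMultiplierCLM ℂ (schrodingerSymbol n t)

/-! ### The equation -/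

/-- The nonlinearity `|x|^{-b} |w|^α w`. -/
def nonlinearity {n : ℕ} (b α : ℝ) (w : Space n → ℂ) (x : Space n) : ℂ :=
  ((‖x‖ ^ (-b) * ‖w x‖ ^ α : ℝ) : ℂ) * w x

/-- `u` (defined for positive times) solves
`u(t) = e^{itΔ} φ + i γ ∫₀ᵗ e^{i(t-τ)Δ} (|x|^{-b} |u|^α u)(τ) dτ` for all `t > 0`, as an
identity of tempered distributions, the integral being tested against Schwartz functions and
required to converge absolutely. -/
def IsGlobalSolution {n : ℕ} (b α γ : ℝ) (φ : 𝓢'(Space n, ℂ)) (u : ℝ → Space n → ℂ) : Prop :=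
  ∃ U N : ℝ → 𝓢'(Space n, ℂ),
    (∀ t > 0, Represents (U t) (u t)) ∧
    (∀ t > 0, Represents (N t) (nonlinearity b α (u t))) ∧
    ∀ t > 0, ∀ ψ : 𝓢(Space n, ℂ),
      IntervalIntegrable (fun τ => schrodingerGroup (t - τ) (N τ) ψ) volume 0 t ∧
      U t ψ = schrodingerGroup t φ ψ
        + Complex.I * (γ : ℂ) * ∫ τ in (0 : ℝ)..t, schrodingerGroup (t - τ) (N τ) ψ

/-! ### Parameters -/

/-- `r = n(α+2)/(n-b)`. -/
def rExp (n : ℕ) (b α : ℝ) : ℝ := n * (α + 2) / (n - b)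

/-- `β = (4-2b-α(n-2)) / (2α(α+2))`. -/
def betaExp (n : ℕ) (b α : ℝ) : ℝ := (4 - 2 * b - α * (n - 2)) / (2 * α * (α + 2))

/-- The beta function `B(μ,ν) = ∫₀¹ (1-s)^{μ-1} s^{ν-1} ds`, for `μ, ν > 0`. -/
def betaFun (μ ν : ℝ) : ℝ := ∫ s in (0 : ℝ)..1, (1 - s) ^ (μ - 1) * s ^ (ν - 1)

end INLS

end

/-! Let X(t) be the L^{r,q} norm of u(t) - v(t) and κ = (n/2)(1/r' - 1/r). Subtract the two Duhamel
formulas. The dispersive estimate from L^{r',q} to L^{r,q}, with constant C s^{-κ}, and Hölder's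
inequality for the difference of the nonlinearities, whose factor |u|^α + |v|^α costs (M τ^{-β})^α,
give X(t) ≤ C ‖e^{itΔ}(φ-ϕ)‖ + C M^α ∫₀ᵗ (t-τ)^{-κ} τ^{-βα} X(τ) dτ. Scaling forces κ + βα = 1.
Hence, after multiplication by t^{β+h} and the substitution τ = ts, the kernel is (1-s)^{-κ}
s^{-βα-β-h}, free of t, and its mass is the Beta function of the hypothesis. Smallness turns the
integral into a contraction by 1/2 for t^{β+h} X(t). Absorption first shows that this quantity is
bounded. Then, because the times in any fixed bounded interval contribute o(1) as t → ∞, its limsup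
is at most a fixed fraction of itself, hence zero (`IsSubsolution.tendsto_zero`).

The harmonic analysis is carried out on the dyadic sequence 2^{m/p} f*(2^m), whose ℓ^q norm is
equivalent to the Lorentz norm. The dispersive estimate is proved in dual form: N is cut into layers
of measure about 2^m and paired with the flow of an atom of scale 2^l. The L¹ → L^∞ decay and the
conservation of L² give two bounds; their minimum depends, up to a weight in m, only on m + l and is
summable because r > 2 (`enorm_integral_mul_testFlow_le`). Conversely, testing against finite
combinations of atoms recovers the ℓ^q norm (`seqNorm_le_of_forall_pairing`). Testing precedes
integration in time, so that the Duhamel integral is always a scalar one (`duhamel_estimate`). -/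

namespace INLS

/-! ### The free flow on test functions: L² conservation and L¹ → L^∞ decay -/

open FourierTransform in
/-- The action of `e^{isΔ}` on test functions, the transpose of `schrodingerGroup s`. -/
noncomputable def testFlow {n : ℕ} (s : ℝ) : 𝓢(Space n, ℂ) →L[ℂ] 𝓢(Space n, ℂ) :=
  fourierCLM ℂ 𝓢(Space n, ℂ) ∘L (SchwartzMap.smulLeftCLM ℂ (schrodingerSymbol n s)) ∘L
    fourierInvCLM ℂ 𝓢(Space n, ℂ)

theorem schrodingerGroup_apply {n : ℕ} (s : ℝ) (T : 𝓢'(Space n, ℂ)) (ψ : 𝓢(Space n, ℂ)) :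
    schrodingerGroup s T ψ = T (testFlow s ψ) := rfl

theorem norm_schrodingerSymbol {n : ℕ} (s : ℝ) (ξ : Space n) : ‖schrodingerSymbol n s ξ‖ = 1 := by
  rw [schrodingerSymbol, Complex.norm_exp_ofReal_mul_I]

-- Plancherel twice, the symbol being unimodular.
open FourierTransform in
theorem integral_norm_sq_testFlow {n : ℕ} (s : ℝ) (ψ : 𝓢(Space n, ℂ)) :
    ∫ x, ‖testFlow s ψ x‖ ^ 2 = ∫ x, ‖ψ x‖ ^ 2 := by
  have h1 : ∫ x, ‖testFlow s ψ x‖ ^ 2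
      = ∫ x, ‖SchwartzMap.smulLeftCLM ℂ (schrodingerSymbol n s) (𝓕⁻ ψ) x‖ ^ 2 :=
    SchwartzMap.integral_norm_sq_fourier _
  have h2 := SchwartzMap.integral_norm_sq_fourier (𝓕⁻ ψ)
  rw [fourier_fourierInv_eq] at h2
  rw [h1, h2]
  congr 1 with x
  rw [SchwartzMap.smulLeftCLM_apply_apply (schrodingerSymbol_hasTemperateGrowth n s), norm_smul,
    norm_schrodingerSymbol, one_mul]

-- The factor e^{-ε|v|²} makes the symbol an integrable Gaussian with complex parameter c = ε + 4π²s
-- i, whose Fourier transform is explicit. Shifting the transform from ψ to the Gaussian leaves the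
-- sup bound |π/c|^{n/2}, and |c| ≥ 4π²s makes it uniform in ε.
open FourierTransform in
theorem norm_integral_gaussian_mul_fourierInv_le {n : ℕ} {s : ℝ} (hs : 0 < s) {ε : ℝ} (hε : 0 < ε)
    (ψ : 𝓢(Space n, ℂ)) (x : Space n) :
    ‖∫ v, (𝓕⁻ ψ) v * Complex.exp (-((ε : ℂ) + 4 * Real.pi ^ 2 * s * Complex.I) * ‖v‖ ^ 2
        + 2 * Real.pi * Complex.I * (inner ℝ (-x) v : ℝ))‖
      ≤ s ^ (-(n : ℝ) / 2) * ∫ y, ‖ψ y‖ := by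
  set c : ℂ := (ε : ℂ) + 4 * Real.pi ^ 2 * s * Complex.I with hc
  have hre : 0 < c.re := by simp [hc, ← Complex.ofReal_pow, hε]
  have him : c.im = 4 * Real.pi ^ 2 * s := by simp [hc, ← Complex.ofReal_pow]
  set G : Space n → ℂ := fun v => Complex.exp (-c * ‖v‖ ^ 2
        + 2 * Real.pi * Complex.I * (inner ℝ (-x) v : ℝ)) with hG
  have hGi : Integrable G := GaussianFourier.integrable_cexp_neg_mul_sq_norm_add hre _ _
  have hψi : Integrable (fun y => ψ (-y)) := ψ.integrable.comp_neg
  have key : ∫ v, (𝓕⁻ ψ) v * G v = ∫ y, ψ (-y) * 𝓕 G y := by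
    have h := VectorFourier.integral_fourierIntegral_smul_eq_flip (L := innerₗ (Space n))
      (μ := volume) (ν := volume) Real.continuous_fourierChar continuous_inner hψi hGi
    have e1 : ∀ v, (𝓕⁻ ψ) v =
        VectorFourier.fourierIntegral Real.fourierChar volume (innerₗ (Space n))
          (fun y => ψ (-y)) v := by
      intro v
      rw [SchwartzMap.fourierInv_coe, Real.fourierInv_eq_fourier_comp_neg]
      rfl
    simp only [e1]
    simp only [smul_eq_mul, flip_innerₗ] at h
    exact h
  have hb : ∀ y, ‖𝓕 G y‖ ≤ s ^ (-(n : ℝ) / 2) := by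
    intro y
    rw [hG, fourier_gaussian_innerProductSpace' hre, norm_mul]
    have hcn : 4 * Real.pi ^ 2 * s ≤ ‖c‖ := by
      rw [← him]; exact (le_abs_self _).trans (Complex.abs_im_le_norm c)
    have hc0 : 0 < ‖c‖ := lt_of_lt_of_le (by positivity) hcn
    have h1 : ‖Complex.exp (-Real.pi ^ 2 * ‖-x - y‖ ^ 2 / c)‖ ≤ 1 := by
      rw [Complex.norm_exp]
      apply Real.exp_le_one_iff.mpr
      have : (-Real.pi ^ 2 * ‖-x - y‖ ^ 2 / c : ℂ)
          = ((-(Real.pi ^ 2 * ‖-x - y‖ ^ 2) : ℝ) : ℂ) * c⁻¹ := by push_cast; ring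
      rw [this, Complex.re_ofReal_mul, Complex.inv_re]
      have : 0 ≤ c.re / Complex.normSq c := div_nonneg hre.le (Complex.normSq_nonneg _)
      have h3 : 0 ≤ Real.pi ^ 2 * ‖-x - y‖ ^ 2 := by positivity
      nlinarith
    have h2 : ‖((Real.pi : ℂ) / c) ^ ((Module.finrank ℝ (Space n) : ℂ) / 2)‖
        ≤ s ^ (-(n : ℝ) / 2) := by
      have e : ((Module.finrank ℝ (Space n) : ℂ) / 2) = (((n : ℝ) / 2 : ℝ) : ℂ) := by simp
      rw [e, Complex.norm_cpow_real, norm_div, Complex.norm_real, Real.norm_of_nonneg Real.pi_pos.le,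
        neg_div, Real.rpow_neg hs.le, ← Real.inv_rpow hs.le]
      apply Real.rpow_le_rpow (by positivity) _ (by positivity)
      rw [div_le_iff₀ hc0, inv_mul_eq_div, le_div_iff₀ hs]
      nlinarith [Real.pi_gt_three, mul_pos Real.pi_pos hs]
    calc _ ≤ s ^ (-(n : ℝ) / 2) * 1 := mul_le_mul h2 h1 (norm_nonneg _) (by positivity)
      _ = _ := mul_one _
  rw [key]
  calc ‖∫ y, ψ (-y) * 𝓕 G y‖ ≤ ∫ y, ‖ψ (-y) * 𝓕 G y‖ := norm_integral_le_integral_norm _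
    _ ≤ ∫ y, s ^ (-(n : ℝ) / 2) * ‖ψ (-y)‖ := by
        apply integral_mono_of_nonneg (Eventually.of_forall fun _ => norm_nonneg _)
          (hψi.norm.const_mul _)
        refine Eventually.of_forall fun y => ?_
        simp only [norm_mul]
        rw [mul_comm]
        exact mul_le_mul_of_nonneg_right (hb y) (norm_nonneg _)
    _ = _ := by
        rw [integral_const_mul, integral_neg_eq_self (fun y => ‖ψ y‖)]

open FourierTransform in
/-- The dispersive estimate for test functions. -/
theorem norm_testFlow_le {n : ℕ} {s : ℝ} (hs : 0 < s) (ψ : 𝓢(Space n, ℂ)) (x : Space n) :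
    ‖testFlow s ψ x‖ ≤ s ^ (-(n : ℝ) / 2) * ∫ y, ‖ψ y‖ := by
  set E : ℝ → Space n → ℂ := fun ε v =>
    Complex.exp (-((ε : ℂ) + 4 * Real.pi ^ 2 * s * Complex.I) * ‖v‖ ^ 2
        + 2 * Real.pi * Complex.I * (inner ℝ (-x) v : ℝ)) with hE
  have hrepr : testFlow s ψ x = ∫ v, (𝓕⁻ ψ) v * E 0 v := by
    change 𝓕 (SchwartzMap.smulLeftCLM ℂ (schrodingerSymbol n s) (𝓕⁻ ψ)) x = _
    rw [SchwartzMap.fourier_coe, Real.fourier_eq']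
    congr 1 with v
    rw [SchwartzMap.smulLeftCLM_apply_apply (schrodingerSymbol_hasTemperateGrowth n s),
      smul_eq_mul, smul_eq_mul, ← mul_assoc, schrodingerSymbol, ← Complex.exp_add, mul_comm]
    congr 2
    rw [real_inner_comm, inner_neg_left]
    push_cast
    ring
  have hEn : ∀ ε ≥ 0, ∀ v, ‖E ε v‖ ≤ 1 := by
    intro ε hε v
    rw [hE]
    simp only
    rw [Complex.norm_exp]
    apply Real.exp_le_one_iff.mpr
    have : (-((ε : ℂ) + 4 * Real.pi ^ 2 * s * Complex.I) * ‖v‖ ^ 2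
        + 2 * Real.pi * Complex.I * (inner ℝ (-x) v : ℝ))
        = ((-(ε * ‖v‖ ^ 2) : ℝ) : ℂ) +
          ((-(4 * Real.pi ^ 2 * s * ‖v‖ ^ 2) + 2 * Real.pi * inner ℝ (-x) v : ℝ) : ℂ)
            * Complex.I := by
      push_cast; ring
    rw [this]
    simp only [Complex.add_re, Complex.ofReal_re, Complex.mul_re, Complex.I_re, Complex.I_im,
      Complex.ofReal_im]
    have : 0 ≤ ε * ‖v‖ ^ 2 := by positivity
    linarith
  -- The regularised bound does not depend on ε, so it survives ε → 0; dominated convergence applies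
  -- because 𝓕⁻ ψ is integrable.
  have hlim : Tendsto (fun ε : ℝ => ∫ v, (𝓕⁻ ψ) v * E ε v) (𝓝[>] 0)
      (𝓝 (∫ v, (𝓕⁻ ψ) v * E 0 v)) := by
    apply tendsto_integral_filter_of_dominated_convergence (fun v => ‖(𝓕⁻ ψ) v‖)
    · refine Eventually.of_forall fun ε => ?_
      apply Continuous.aestronglyMeasurable
      have := (𝓕⁻ ψ).continuous
      fun_prop
    · filter_upwards [self_mem_nhdsWithin] with ε hε
      refine Eventually.of_forall fun v => ?_
      rw [norm_mul]
      exact mul_le_of_le_one_right (norm_nonneg _) (hEn ε (le_of_lt hε) v)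
    · exact (𝓕⁻ ψ).integrable.norm
    · refine Eventually.of_forall fun v => ?_
      have : Continuous (fun ε : ℝ => (𝓕⁻ ψ) v * E ε v) := by fun_prop
      exact (this.tendsto 0).mono_left nhdsWithin_le_nhds
  rw [hrepr]
  refine le_of_tendsto hlim.norm ?_
  filter_upwards [self_mem_nhdsWithin] with ε hε
  exact norm_integral_gaussian_mul_fourierInv_le hs hε ψ x

/-! ### Decreasing rearrangements -/

section Rearrangement

variable {n : ℕ} {f g : Space n → ℂ}

theorem distribFun_anti {a c : ℝ≥0} (h : a ≤ c) : distribFun f c ≤ distribFun f a :=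
  measure_mono fun _ hx => lt_of_le_of_lt h hx

/-- The infimum runs over positive levels only, so level 0 is reached through lam + ε. -/
theorem rearrangement_le {lam : ℝ≥0} {t : ℝ} (h : distribFun f lam ≤ ENNReal.ofReal t) :
    rearrangement f t ≤ lam := by
  apply ENNReal.le_of_forall_pos_le_add
  intro ε hε _
  have h1 : distribFun f (lam + ε) ≤ ENNReal.ofReal t := (distribFun_anti le_self_add).trans h
  exact (iInf₂_le_of_le (lam + ε) (by positivity) (iInf_le _ h1)).trans (by simp)

theorem lt_distribFun_of_lt_rearrangement {lam : ℝ≥0} {t : ℝ} (h : lam < rearrangement f t) :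
    ENNReal.ofReal t < distribFun f lam := by
  by_contra! hc
  exact absurd (rearrangement_le hc) (not_le.mpr h)

theorem rearrangement_anti {s t : ℝ} (h : s ≤ t) : rearrangement f t ≤ rearrangement f s :=
  le_iInf fun lam => le_iInf fun hlam => le_iInf fun hd =>
    iInf_le_of_le lam (iInf_le_of_le hlam (iInf_le _ (hd.trans (ENNReal.ofReal_le_ofReal h))))

/-- The distribution function is right-continuous (continuity of the measure along the increasing
sets |f| > lam + 1/(k+1)), so the infimum defining f* is attained. No measurability of f is needed.
-/
theorem distribFun_le_of_rearrangement_le {lam : ℝ≥0} {t : ℝ} (h : rearrangement f t ≤ lam) :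
    distribFun f lam ≤ ENNReal.ofReal t := by
  have hU : {x | lam < ‖f x‖₊} = ⋃ k : ℕ, {x | lam + 1 / ((k : ℝ≥0) + 1) < ‖f x‖₊} := by
    ext x
    simp only [mem_ofPred_eq, mem_iUnion]
    constructor
    · intro hx
      obtain ⟨k, hk⟩ := exists_nat_one_div_lt (tsub_pos_of_lt hx)
      exact ⟨k, by rw [add_comm]; exact lt_tsub_iff_right.mp hk⟩
    · rintro ⟨k, hk⟩
      exact lt_of_le_of_lt le_self_add hk
  have hmono : Monotone fun k : ℕ => {x | lam + 1 / ((k : ℝ≥0) + 1) < ‖f x‖₊} := by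
    intro i j hij
    refine fun x (hx : lam + 1 / ((i : ℝ≥0) + 1) < ‖f x‖₊) => lt_of_le_of_lt ?_ hx
    gcongr
  rw [distribFun, hU, hmono.measure_iUnion]
  refine iSup_le fun k => ?_
  have hlt : rearrangement f t < ((lam + 1 / ((k : ℝ≥0) + 1) : ℝ≥0) : ℝ≥0∞) := by
    refine lt_of_le_of_lt h ?_
    rw [ENNReal.coe_lt_coe]
    exact lt_add_of_pos_right _ (by positivity)
  rw [rearrangement] at hlt
  simp only [iInf_lt_iff] at hlt
  obtain ⟨a, _, hd, ha⟩ := hlt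
  exact (distribFun_anti (ENNReal.coe_lt_coe.mp ha).le).trans hd

theorem rearrangement_add_le {s t : ℝ} (hs : 0 ≤ s) (ht : 0 ≤ t) :
    rearrangement (fun x => f x + g x) (s + t) ≤ rearrangement f s + rearrangement g t := by
  rcases eq_or_ne (rearrangement f s) ∞ with hf | hf
  · simp [hf]
  rcases eq_or_ne (rearrangement g t) ∞ with hg | hg
  · simp [hg]
  lift rearrangement f s to ℝ≥0 using hf with a ha
  lift rearrangement g t to ℝ≥0 using hg with c hc
  rw [← ENNReal.coe_add]
  apply rearrangement_le
  rw [ENNReal.ofReal_add hs ht]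
  refine le_trans (measure_mono (t := {x | a < ‖f x‖₊} ∪ {x | c < ‖g x‖₊}) ?_)
    ((measure_union_le _ _).trans (add_le_add (distribFun_le_of_rearrangement_le ha.ge)
      (distribFun_le_of_rearrangement_le hc.ge)))
  intro x hx
  by_contra hcon
  simp only [mem_union, mem_ofPred_eq, not_or, not_lt] at hcon hx
  exact absurd ((nnnorm_add_le _ _).trans (add_le_add hcon.1 hcon.2)) (not_le.mpr hx)

theorem rearrangement_neg (t : ℝ) : rearrangement (fun x => -f x) t = rearrangement f t := by
  simp [rearrangement, distribFun]

end Rearrangement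

/-! ### Sequence norms -/

/-- The norm of `ℓ^q(ℤ)` for sequences with values in `[0, ∞]`. -/
noncomputable def seqNorm (q : ℝ≥0∞) (x : ℤ → ℝ≥0∞) : ℝ≥0∞ :=
  if q = ∞ then ⨆ m, x m else (∑' m, x m ^ q.toReal) ^ (1 / q.toReal)

/-- The norm of `ℓ^{q'}(S)` for a finite set `S`, where `q'` is the exponent conjugate to `q`. -/
noncomputable def dualNorm (q : ℝ≥0∞) (S : Finset ℤ) (z : ℤ → ℝ≥0∞) : ℝ≥0∞ :=
  if q = ∞ then ∑ l ∈ S, z l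
  else (∑ l ∈ S, z l ^ q.toReal.conjExponent) ^ (1 / q.toReal.conjExponent)

section SeqNorm

variable {q : ℝ≥0∞} {x y : ℤ → ℝ≥0∞}

theorem seqNorm_mono (h : ∀ m, x m ≤ y m) : seqNorm q x ≤ seqNorm q y := by
  unfold seqNorm
  split_ifs
  · exact iSup_mono h
  · gcongr with m
    exact h m

theorem le_seqNorm (hq : q ≠ 0) (m : ℤ) : x m ≤ seqNorm q x := by
  unfold seqNorm
  split_ifs with h
  · exact le_iSup x m
  · have h0 : 0 < q.toReal := ENNReal.toReal_pos hq h
    rw [one_div, ENNReal.le_rpow_inv_iff h0]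
    exact ENNReal.le_tsum m

theorem seqNorm_const_mul (hq : q ≠ 0) (c : ℝ≥0∞) :
    seqNorm q (fun m => c * x m) = c * seqNorm q x := by
  unfold seqNorm
  split_ifs with h
  · rw [ENNReal.mul_iSup]
  · have h0 : 0 < q.toReal := ENNReal.toReal_pos hq h
    simp_rw [ENNReal.mul_rpow_of_nonneg _ _ h0.le]
    rw [ENNReal.tsum_mul_left, ENNReal.mul_rpow_of_nonneg _ _ (by positivity), ← ENNReal.rpow_mul,
      mul_one_div_cancel h0.ne', ENNReal.rpow_one]

theorem seqNorm_shift (k : ℤ) : seqNorm q (fun m => x (m + k)) = seqNorm q x := by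
  unfold seqNorm
  split_ifs with h
  · exact (Equiv.addRight k).iSup_comp (g := x)
  · rw [← (Equiv.addRight k).tsum_eq (fun m => x m ^ q.toReal)]
    rfl

/-- The crude constant 2 comes from x + y ≤ 2 max(x, y); the power 1/q ≤ 1 is then subadditive. -/
theorem seqNorm_add_le (hq : 1 ≤ q) :
    seqNorm q (fun m => x m + y m) ≤ 2 * (seqNorm q x + seqNorm q y) := by
  have hq0 : q ≠ 0 := (zero_lt_one.trans_le hq).ne'
  have h1 : seqNorm q (fun m => x m + y m) ≤ seqNorm q (fun m => 2 * max (x m) (y m)) := by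
    apply seqNorm_mono
    intro m
    rw [two_mul]
    exact add_le_add (le_max_left _ _) (le_max_right _ _)
  rw [seqNorm_const_mul hq0] at h1
  refine h1.trans ?_
  gcongr
  unfold seqNorm
  split_ifs with h
  · refine iSup_le fun m => max_le ?_ ?_
    · exact (le_iSup x m).trans le_self_add
    · exact (le_iSup y m).trans le_add_self
  · have hq1 : 1 ≤ q.toReal := by
      rw [← ENNReal.toReal_one]; exact ENNReal.toReal_mono h hq
    refine le_trans ?_ (ENNReal.rpow_add_le_add_rpow _ _ (by positivity)
      ((div_le_one (by linarith)).mpr hq1))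
    rw [← ENNReal.tsum_add]
    gcongr with m
    dsimp only
    rcases le_total (x m) (y m) with hxy | hxy
    · rw [max_eq_right hxy]; exact le_add_self
    · rw [max_eq_left hxy]; exact le_self_add

theorem sum_mul_le_dualNorm_mul_seqNorm (hq : 1 < q) (S : Finset ℤ) (z : ℤ → ℝ≥0∞)
    {e : ℤ → ℤ} (he : Function.Injective e) :
    ∑ l ∈ S, z l * y (e l) ≤ dualNorm q S z * seqNorm q y := by
  unfold dualNorm seqNorm
  split_ifs with h
  · rw [Finset.sum_mul]
    gcongr with l
    exact le_iSup y _
  · have hq1 : 1 < q.toReal := by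
      rw [← ENNReal.toReal_one]
      exact (ENNReal.toReal_lt_toReal ENNReal.one_ne_top h).mpr hq
    refine (ENNReal.inner_le_Lp_mul_Lq S z (fun l => y (e l))
      (Real.HolderConjugate.conjExponent hq1).symm).trans ?_
    gcongr
    calc ∑ l ∈ S, y (e l) ^ q.toReal ≤ ∑' l, y (e l) ^ q.toReal := ENNReal.sum_le_tsum S
      _ ≤ ∑' m, y m ^ q.toReal :=
        ENNReal.tsum_comp_le_tsum_of_injective he (fun m => y m ^ q.toReal)

end SeqNorm

/-! ### Discretisation of the Lorentz norm -/

/-- The sequence `2^{m/p} f*(2^m)`, whose `ℓ^q` norm is equivalent to the `L^{p,q}` norm. -/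
noncomputable def lorentzSeq {n : ℕ} (p : ℝ) (f : Space n → ℂ) (m : ℤ) : ℝ≥0∞ :=
  (2 : ℝ≥0∞) ^ ((m : ℝ) / p) * rearrangement f ((2 : ℝ) ^ m)

theorem ofReal_two_zpow (m : ℤ) : ENNReal.ofReal ((2 : ℝ) ^ m) = (2 : ℝ≥0∞) ^ (m : ℝ) := by
  rw [← Real.rpow_intCast, ← ENNReal.ofReal_rpow_of_pos two_pos]
  simp

theorem two_rpow_add (x y : ℝ) : (2 : ℝ≥0∞) ^ (x + y) = 2 ^ x * 2 ^ y :=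
  ENNReal.rpow_add x y two_ne_zero ENNReal.ofNat_ne_top

theorem two_rpow_ne_top (x : ℝ) : (2 : ℝ≥0∞) ^ x ≠ ∞ := by
  simp

theorem two_rpow_ne_zero (x : ℝ) : (2 : ℝ≥0∞) ^ x ≠ 0 := by
  simp

section Equivalence

variable {n : ℕ} {p : ℝ} {f : Space n → ℂ}

theorem ofReal_rpow_mul_rearrangement_le (hp : 0 < p) {m : ℤ} {t : ℝ}
    (ht : t ∈ Ico ((2 : ℝ) ^ m) (2 ^ (m + 1))) :
    ENNReal.ofReal (t ^ (1 / p)) * rearrangement f t ≤ 2 ^ (1 / p) * lorentzSeq p f m := by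
  have ht0 : 0 < t := lt_of_lt_of_le (by positivity) ht.1
  rw [lorentzSeq, ← mul_assoc, ← two_rpow_add]
  refine mul_le_mul' ?_ (rearrangement_anti ht.1)
  rw [← ENNReal.ofReal_rpow_of_pos ht0]
  calc ENNReal.ofReal t ^ (1 / p) ≤ (2 ^ ((m + 1 : ℤ) : ℝ)) ^ (1 / p) := by
        gcongr
        rw [← ofReal_two_zpow]
        exact ENNReal.ofReal_le_ofReal ht.2.le
    _ = _ := by
        rw [← ENNReal.rpow_mul]
        congr 1
        push_cast; ring

theorem lorentzSeq_succ_le (hp : 0 < p) {m : ℤ} {t : ℝ}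
    (ht : t ∈ Ico ((2 : ℝ) ^ m) (2 ^ (m + 1))) :
    lorentzSeq p f (m + 1) ≤
      2 ^ (1 / p) * (ENNReal.ofReal (t ^ (1 / p)) * rearrangement f t) := by
  have ht0 : 0 < t := lt_of_lt_of_le (by positivity) ht.1
  rw [lorentzSeq, ← mul_assoc]
  refine mul_le_mul' ?_ (rearrangement_anti ht.2.le)
  rw [← ENNReal.ofReal_rpow_of_pos ht0]
  calc (2 : ℝ≥0∞) ^ (((m + 1 : ℤ) : ℝ) / p) = 2 ^ (1 / p) * (2 ^ (m : ℝ)) ^ (1 / p) := by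
        rw [← ENNReal.rpow_mul, ← two_rpow_add]
        congr 1
        push_cast; ring
    _ ≤ _ := by
        gcongr
        rw [← ofReal_two_zpow]
        exact ENNReal.ofReal_le_ofReal ht.1

theorem iUnion_Ico_two_zpow : (⋃ m : ℤ, Ico ((2 : ℝ) ^ m) (2 ^ (m + 1))) = Ioi 0 := by
  ext t
  simp only [mem_iUnion, mem_Ioi]
  constructor
  · rintro ⟨m, hm⟩
    exact lt_of_lt_of_le (by positivity) hm.1
  · intro ht
    exact exists_mem_Ico_zpow ht one_lt_two

theorem setLIntegral_Ioi_eq_tsum (F : ℝ → ℝ≥0∞) :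
    ∫⁻ t in Ioi (0 : ℝ), F t = ∑' m : ℤ, ∫⁻ t in Ico ((2 : ℝ) ^ m) (2 ^ (m + 1)), F t := by
  rw [← iUnion_Ico_two_zpow, lintegral_iUnion (fun _ => measurableSet_Ico)]
  have hmono : Monotone fun m : ℤ => (2 : ℝ) ^ m := zpow_right_mono₀ one_le_two
  exact hmono.pairwise_disjoint_on_Ico_succ

theorem volume_Ico_two_zpow (m : ℤ) :
    volume (Ico ((2 : ℝ) ^ m) (2 ^ (m + 1))) = 2 ^ (m : ℝ) := by
  rw [Real.volume_Ico, ← ofReal_two_zpow]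
  congr 1
  rw [zpow_add_one₀ two_ne_zero]; ring

/-- On the block [2^m, 2^{m+1}) the integrand is controlled by its value at 2^m, and dt/t has mass
at most 1 there. -/
theorem lorentzNorm_le_seqNorm (hp : 0 < p) {q : ℝ≥0∞} (hq : q ≠ 0) :
    ∃ C : ℝ≥0, ∀ f : Space n → ℂ, lorentzNorm p q f ≤ C * seqNorm q (lorentzSeq p f) := by
  rcases eq_or_ne q ∞ with rfl | hqt
  · refine ⟨2 ^ (1 / p), fun f => ?_⟩
    rw [lorentzNorm, seqNorm, if_pos rfl, if_pos rfl]
    refine iSup₂_le fun t ht => ?_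
    obtain ⟨m, hm⟩ := exists_mem_Ico_zpow ht one_lt_two
    refine (ofReal_rpow_mul_rearrangement_le hp hm).trans ?_
    rw [ENNReal.coe_rpow_of_nonneg _ (by positivity)]
    exact mul_le_mul' le_rfl (le_iSup (lorentzSeq p f) m)
  · have h0 : 0 < q.toReal := ENNReal.toReal_pos hq hqt
    refine ⟨(ENNReal.ofReal (q.toReal / p) ^ (1 / q.toReal)).toNNReal * 2 ^ (1 / p), fun f => ?_⟩
    rw [lorentzNorm, if_neg hqt, ENNReal.coe_mul, ENNReal.coe_toNNReal (by simp [h0.le]),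
      ENNReal.coe_rpow_of_nonneg _ (by positivity), ENNReal.mul_rpow_of_nonneg _ _ (by positivity),
      mul_assoc, ← seqNorm_const_mul hq, seqNorm, if_neg hqt, setLIntegral_Ioi_eq_tsum]
    gcongr with m
    calc _ ≤ ∫⁻ t in Ico ((2 : ℝ) ^ m) (2 ^ (m + 1)),
          (2 ^ (1 / p) * lorentzSeq p f m) ^ q.toReal * 2 ^ (-(m : ℝ)) := by
          refine setLIntegral_mono' measurableSet_Ico fun t ht => ?_
          have ht0 : 0 < t := lt_of_lt_of_le (by positivity) ht.1
          refine mul_le_mul' (ENNReal.rpow_le_rpow (ofReal_rpow_mul_rearrangement_le hp ht) h0.le) ?_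
          · rw [ENNReal.rpow_neg, ← ofReal_two_zpow, ← ENNReal.ofReal_inv_of_pos (by positivity),
              one_div]
            exact ENNReal.ofReal_le_ofReal (inv_anti₀ (by positivity) ht.1)
      _ = _ := by
          rw [setLIntegral_const, volume_Ico_two_zpow, mul_assoc, ← two_rpow_add]
          simp

/-- For finite q the entry m + 1 is compared with the block [2^m, 2^{m+1}), on which f* is at least
f*(2^{m+1}); hence the shift by one. The mass of dt/t on that block is at least 1/2, which is the 2
in 2 / c. -/
theorem seqNorm_le_lorentzNorm (hp : 0 < p) {q : ℝ≥0∞} (hq : q ≠ 0) :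
    ∃ C : ℝ≥0, ∀ f : Space n → ℂ, seqNorm q (lorentzSeq p f) ≤ C * lorentzNorm p q f := by
  rcases eq_or_ne q ∞ with rfl | hqt
  · refine ⟨1, fun f => ?_⟩
    rw [lorentzNorm, seqNorm, if_pos rfl, if_pos rfl, ENNReal.coe_one, one_mul]
    refine iSup_le fun m => ?_
    refine le_iSup₂_of_le ((2 : ℝ) ^ m) (by positivity) (mul_le_mul' (le_of_eq ?_) le_rfl)
    rw [← ENNReal.ofReal_rpow_of_pos (by positivity), ofReal_two_zpow, ← ENNReal.rpow_mul]
    congr 1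
    ring
  · have h0 : 0 < q.toReal := ENNReal.toReal_pos hq hqt
    set c : ℝ≥0∞ := ENNReal.ofReal (q.toReal / p) with hc
    have hc0 : c ≠ 0 := by simp [hc]; positivity
    have hct : c ≠ ∞ := ENNReal.ofReal_ne_top
    refine ⟨(2 ^ (1 / p) * (2 / c) ^ (1 / q.toReal)).toNNReal, fun f => ?_⟩
    have hfin : (2 : ℝ≥0∞) ^ (1 / p) * (2 / c) ^ (1 / q.toReal) ≠ ∞ :=
      ENNReal.mul_ne_top (two_rpow_ne_top _)
        (ENNReal.rpow_ne_top_of_nonneg (by positivity) (ENNReal.div_ne_top (by simp) hc0))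
    rw [ENNReal.coe_toNNReal hfin, lorentzNorm, if_neg hqt, mul_assoc,
      ← ENNReal.mul_rpow_of_nonneg _ _ (by positivity), ← mul_assoc, ENNReal.div_mul_cancel hc0 hct,
      ← seqNorm_shift 1, seqNorm, if_neg hqt]
    have hpw : (2 : ℝ≥0∞) ^ (1 / p) = ((2 ^ (1 / p)) ^ q.toReal) ^ (1 / q.toReal) := by
      rw [← ENNReal.rpow_mul, mul_one_div_cancel h0.ne', ENNReal.rpow_one]
    rw [hpw, ← ENNReal.mul_rpow_of_nonneg _ _ (by positivity), setLIntegral_Ioi_eq_tsum,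
      ← ENNReal.tsum_mul_left, ← ENNReal.tsum_mul_left]
    gcongr with m
    have h2 : (2 : ℝ≥0∞) ^ (-((m : ℝ) + 1)) * 2 ^ (m : ℝ) * 2 = 1 := by
      nth_rewrite 3 [← ENNReal.rpow_one 2]
      rw [← two_rpow_add, ← two_rpow_add]
      simp
    calc lorentzSeq p f (m + 1) ^ q.toReal
        = lorentzSeq p f (m + 1) ^ q.toReal * 2 ^ (-((m : ℝ) + 1)) * 2 ^ (m : ℝ) * 2 := by
          rw [mul_assoc, mul_assoc, ← mul_assoc (2 ^ (-((m : ℝ) + 1)) : ℝ≥0∞), h2, mul_one]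
      _ = (∫⁻ t in Ico ((2 : ℝ) ^ m) (2 ^ (m + 1)),
            lorentzSeq p f (m + 1) ^ q.toReal * 2 ^ (-((m : ℝ) + 1))) * 2 := by
          rw [setLIntegral_const, volume_Ico_two_zpow]
      _ ≤ (∫⁻ t in Ico ((2 : ℝ) ^ m) (2 ^ (m + 1)), (2 ^ (1 / p)) ^ q.toReal *
            ((ENNReal.ofReal (t ^ (1 / p)) * rearrangement f t) ^ q.toReal *
              ENNReal.ofReal (1 / t))) * 2 := by
          gcongr ?_ * 2
          refine setLIntegral_mono' measurableSet_Ico fun t ht => ?_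
          have ht0 : 0 < t := lt_of_lt_of_le (by positivity) ht.1
          rw [← mul_assoc, ← ENNReal.mul_rpow_of_nonneg _ _ h0.le]
          gcongr
          · exact lorentzSeq_succ_le hp ht
          · have : (m : ℝ) + 1 = ((m + 1 : ℤ) : ℝ) := by push_cast; ring
            rw [this, ENNReal.rpow_neg, ← ofReal_two_zpow,
              ← ENNReal.ofReal_inv_of_pos (by positivity), one_div]
            exact ENNReal.ofReal_le_ofReal (inv_anti₀ ht0 ht.2.le)
      _ = _ := by
          rw [lintegral_const_mul' _ _ (by
            apply ENNReal.rpow_ne_top_of_nonneg h0.le (two_rpow_ne_top _))]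
          ring

theorem lorentzSeq_add_le {g : Space n → ℂ} (m : ℤ) :
    lorentzSeq p (fun x => f x + g x) (m + 1) ≤
      2 ^ (1 / p) * (lorentzSeq p f m + lorentzSeq p g m) := by
  have h : rearrangement (fun x => f x + g x) ((2 : ℝ) ^ (m + 1)) ≤
      rearrangement f (2 ^ m) + rearrangement g (2 ^ m) := by
    have := rearrangement_add_le (f := f) (g := g) (s := (2 : ℝ) ^ m) (t := (2 : ℝ) ^ m)
      (by positivity) (by positivity)
    rwa [← two_mul, ← zpow_one_add₀ two_ne_zero, add_comm 1 m] at this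
  simp only [lorentzSeq]
  rw [← mul_add, ← mul_assoc, ← two_rpow_add]
  refine mul_le_mul' (le_of_eq ?_) h
  congr 1
  push_cast; ring

theorem seqNorm_lorentzSeq_add_le {g : Space n → ℂ} {q : ℝ≥0∞} (hq : 1 ≤ q) :
    seqNorm q (lorentzSeq p (fun x => f x + g x)) ≤
      2 ^ (1 / p) * (2 * (seqNorm q (lorentzSeq p f) + seqNorm q (lorentzSeq p g))) := by
  rw [← seqNorm_shift 1]
  refine (seqNorm_mono fun m => lorentzSeq_add_le m).trans ?_
  rw [seqNorm_const_mul (zero_lt_one.trans_le hq).ne']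
  gcongr
  exact seqNorm_add_le hq

theorem lorentzSeq_neg : lorentzSeq p (fun x => -f x) = lorentzSeq p f := by
  ext m
  rw [lorentzSeq, rearrangement_neg, lorentzSeq]

end Equivalence

/-! ### Pairing a function in a Lorentz space with test functions -/

/-- The smaller of the two bounds, coming from `L^∞` and from `L²`, for the pairing of two dyadic
pieces whose scales have product `2^j`. -/
noncomputable def pairingKernel (p : ℝ) (A : ℝ≥0∞) (j : ℤ) : ℝ≥0∞ :=
  min (A * 2 ^ ((j : ℝ) / p)) (2 ^ ((j : ℝ) * (1 / p - 1 / 2)))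

theorem summable_min_two_rpow {c d : ℝ} (hc : 0 < c) (hd : 0 < d) :
    Summable fun i : ℤ => min ((2 : ℝ) ^ ((i : ℝ) * c)) (2 ^ (-(i : ℝ) * d)) := by
  have geom : ∀ e : ℝ, 0 < e → Summable fun k : ℕ => (2 : ℝ) ^ (-(k : ℝ) * e) := by
    intro e he
    have : ∀ k : ℕ, (2 : ℝ) ^ (-(k : ℝ) * e) = ((2 : ℝ) ^ (-e)) ^ k := by
      intro k
      rw [← Real.rpow_natCast, ← Real.rpow_mul two_pos.le]
      congr 1; ring
    simp_rw [this]
    exact summable_geometric_of_lt_one (by positivity)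
      (Real.rpow_lt_one_of_one_lt_of_neg one_lt_two (by linarith))
  apply Summable.of_nat_of_neg
  · refine Summable.of_nonneg_of_le (fun k => by positivity) (fun k => ?_) (geom d hd)
    simp
  · refine Summable.of_nonneg_of_le (fun k => by positivity) (fun k => ?_) (geom c hc)
    simp

/-- The increasing and the decreasing exponential cross where 2^j = a^{-2}, with common value
a^{1-2/p}, and decay geometrically away from there since 1/p > 0 and 1/2 - 1/p > 0. With a =
s^{-n/2} this is the interpolated decay rate. -/
theorem tsum_pairingKernel_le {p : ℝ} (hp : 2 < p) :
    ∃ C : ℝ≥0, ∀ a : ℝ, 0 < a →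
      ∑' j, pairingKernel p (ENNReal.ofReal a) j ≤ C * ENNReal.ofReal (a ^ (1 - 2 / p)) := by
  have hp0 : 0 < p := by linarith
  set d : ℝ := 1 / 2 - 1 / p with hd
  have hd0 : 0 < d := by
    rw [hd, sub_pos]
    exact one_div_lt_one_div_of_lt two_pos hp
  have hs := summable_min_two_rpow (c := 1 / p) (by positivity) hd0
  set κ : ℤ → ℝ := fun i => min ((2 : ℝ) ^ ((i : ℝ) * (1 / p))) (2 ^ (-(i : ℝ) * d)) with hκ
  have hκ0 : ∀ i, 0 ≤ κ i := fun i => by positivity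
  refine ⟨(∑' i, ENNReal.ofReal (2 ^ d * κ i)).toNNReal, fun a ha => ?_⟩
  rw [ENNReal.coe_toNNReal (hs.mul_left _).tsum_ofReal_ne_top, ← ENNReal.tsum_mul_right]
  -- J is the integer scale just below the crossing point; recentring the sum at J leaves a series
  -- that does not depend on a. The rounding costs the factor 2^d.
  obtain ⟨J, hJ1, hJ2⟩ := exists_mem_Ico_zpow (x := a ^ (-2 : ℝ)) (y := 2) (by positivity) one_lt_two
  rw [← (Equiv.addRight J).tsum_eq]
  refine ENNReal.tsum_le_tsum fun i => ?_
  rw [pairingKernel, ← ENNReal.ofReal_mul (by positivity)]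
  have e : ∀ x : ℝ, (2 : ℝ≥0∞) ^ x = ENNReal.ofReal (2 ^ x) := fun x => by
    rw [← ENNReal.ofReal_rpow_of_pos two_pos]; simp
  rw [e, e, ← ENNReal.ofReal_mul ha.le, ← ENNReal.ofReal_min]
  apply ENNReal.ofReal_le_ofReal
  simp only [Equiv.coe_addRight, Int.cast_add]
  have h1 : a * (2 : ℝ) ^ (((i : ℝ) + J) / p) ≤ a ^ (1 - 2 / p) * 2 ^ ((i : ℝ) * (1 / p)) := by
    have : (2 : ℝ) ^ (((i : ℝ) + J) / p) = ((2 : ℝ) ^ J) ^ (1 / p) * 2 ^ ((i : ℝ) * (1 / p)) := by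
      rw [← Real.rpow_intCast, ← Real.rpow_mul two_pos.le, ← Real.rpow_add two_pos]
      congr 1; ring
    rw [this, ← mul_assoc]
    gcongr
    calc a * ((2 : ℝ) ^ J) ^ (1 / p) ≤ a ^ (1 : ℝ) * (a ^ (-2 : ℝ)) ^ (1 / p) := by
          rw [Real.rpow_one]; gcongr
      _ = _ := by
          rw [← Real.rpow_mul ha.le, ← Real.rpow_add ha]
          congr 1; ring
  have h2 : (2 : ℝ) ^ (((i : ℝ) + J) * (1 / p - 1 / 2)) ≤
      a ^ (1 - 2 / p) * (2 ^ d * 2 ^ (-(i : ℝ) * d)) := by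
    have : (2 : ℝ) ^ (((i : ℝ) + J) * (1 / p - 1 / 2))
        = ((2 : ℝ) ^ (J + 1)) ^ (-d) * (2 ^ d * 2 ^ (-(i : ℝ) * d)) := by
      rw [← Real.rpow_intCast, ← Real.rpow_mul two_pos.le, ← Real.rpow_add two_pos,
        ← Real.rpow_add two_pos]
      congr 1; push_cast; rw [hd]; ring
    rw [this]
    gcongr
    calc ((2 : ℝ) ^ (J + 1)) ^ (-d) ≤ (a ^ (-2 : ℝ)) ^ (-d) :=
          Real.rpow_le_rpow_of_nonpos (by positivity) hJ2.le (by linarith)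
      _ = _ := by
          rw [← Real.rpow_mul ha.le]
          congr 1; rw [hd]; ring
  have h3 : (1 : ℝ) ≤ 2 ^ d := Real.one_le_rpow one_le_two hd0.le
  rw [hκ]
  simp only
  have hA : 0 ≤ a ^ (1 - 2 / p) := by positivity
  rcases min_choice ((2 : ℝ) ^ ((i : ℝ) * (1 / p))) (2 ^ (-(i : ℝ) * d)) with h | h
  · rw [h]
    refine (min_le_left _ _).trans (h1.trans ?_)
    have : 0 ≤ a ^ (1 - 2 / p) * (2 : ℝ) ^ ((i : ℝ) * (1 / p)) := by positivity
    nlinarith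
  · rw [h]
    refine (min_le_right _ _).trans (h2.trans (le_of_eq ?_))
    ring

section Pairing

variable {n : ℕ} {p p' : ℝ} {N : Space n → ℂ}

theorem exists_rearrangement_lt (hp' : 0 < p') {K : ℝ≥0} (hN : ∀ m, lorentzSeq p' N m ≤ K)
    {ε : ℝ≥0∞} (hε : 0 < ε) : ∃ m : ℤ, rearrangement N ((2 : ℝ) ^ m) < ε := by
  have hlim : Tendsto (fun k : ℕ => (K : ℝ≥0∞) * ((2 : ℝ≥0∞) ^ (-(1 / p'))) ^ k) atTop
      (𝓝 (K * 0)) := by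
    apply ENNReal.Tendsto.const_mul _ (Or.inr ENNReal.coe_ne_top)
    apply ENNReal.tendsto_pow_atTop_nhds_zero_of_lt_one
    exact ENNReal.rpow_lt_one_of_one_lt_of_neg (by norm_num) (by simp [hp'])
  rw [mul_zero] at hlim
  obtain ⟨k, hk⟩ := (hlim.eventually_lt_const hε).exists
  refine ⟨k, lt_of_le_of_lt ?_ hk⟩
  have h := hN k
  rw [lorentzSeq] at h
  calc rearrangement N ((2 : ℝ) ^ (k : ℤ))
      = 2 ^ (((k : ℤ) : ℝ) / p') * rearrangement N ((2 : ℝ) ^ (k : ℤ)) *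
          2 ^ (-(((k : ℤ) : ℝ) / p')) := by
        rw [mul_right_comm, ← two_rpow_add]; simp
    _ ≤ K * 2 ^ (-(((k : ℤ) : ℝ) / p')) := by gcongr
    _ = _ := by
        rw [← ENNReal.rpow_natCast, ← ENNReal.rpow_mul]
        congr 2
        push_cast; ring

theorem rearrangement_ne_top {K : ℝ≥0} {m : ℤ} (hN : lorentzSeq p' N m ≤ K) :
    rearrangement N ((2 : ℝ) ^ m) ≠ ∞ := by
  intro h
  rw [lorentzSeq, h, ENNReal.mul_top (two_rpow_ne_zero _)] at hN
  exact absurd hN (by simp)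

theorem measure_rearrangement_lt_le (m : ℤ) (h : rearrangement N ((2 : ℝ) ^ m) ≠ ∞) :
    volume {x | rearrangement N ((2 : ℝ) ^ m) < ‖N x‖ₑ} ≤ 2 ^ (m : ℝ) := by
  obtain ⟨a, ha⟩ : ∃ a : ℝ≥0, (a : ℝ≥0∞) = rearrangement N ((2 : ℝ) ^ m) :=
    ⟨_, ENNReal.coe_toNNReal h⟩
  rw [← ha, ← ofReal_two_zpow]
  have := distribFun_le_of_rearrangement_le ha.ge
  rw [distribFun] at this
  simpa [enorm_eq_nnnorm] using this

/-- Layers of N: if m is the least index with N*(2^m) < |N(x)|, then |N(x)| ≤ N*(2^{m-1}) and x lies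
in a set of measure at most 2^m. Such an m exists because N* decays at infinity, and it is bounded
below unless x exceeds every N*(2^{-k}), which happens on a null set. Measurable hulls replace the
level sets, as N is not assumed measurable. -/
theorem ae_enorm_le_tsum (hp' : 0 < p') {K : ℝ≥0} (hN : ∀ m, lorentzSeq p' N m ≤ K) :
    ∀ᵐ x, ‖N x‖ₑ ≤ ∑' m : ℤ, (toMeasurable volume
      {x | rearrangement N ((2 : ℝ) ^ (m + 1)) < ‖N x‖ₑ}).indicator
        (fun _ => rearrangement N ((2 : ℝ) ^ m)) x := by
  have hnull : volume {x | ∀ m : ℤ, rearrangement N ((2 : ℝ) ^ m) < ‖N x‖ₑ} = 0 := by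
    refine le_antisymm (ENNReal.le_of_forall_pos_le_add fun ε hε _ => ?_) zero_le
    have hlim : Tendsto (fun k : ℕ => ((1 / 2 : ℝ≥0∞)) ^ k) atTop (𝓝 0) := by
      apply ENNReal.tendsto_pow_atTop_nhds_zero_of_lt_one
      simp
    obtain ⟨k, hk⟩ := (hlim.eventually_lt_const (ENNReal.coe_pos.mpr hε)).exists
    calc _ ≤ volume {x | rearrangement N ((2 : ℝ) ^ (-(k : ℤ))) < ‖N x‖ₑ} :=
          measure_mono fun x (hx : ∀ m : ℤ, rearrangement N ((2 : ℝ) ^ m) < ‖N x‖ₑ) => hx _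
      _ ≤ 2 ^ ((-(k : ℤ) : ℤ) : ℝ) := measure_rearrangement_lt_le _ (rearrangement_ne_top (hN _))
      _ = (1 / 2) ^ k := by
          rw [one_div, ← ENNReal.inv_pow, ← ENNReal.rpow_natCast, ← ENNReal.rpow_neg]
          congr 1; push_cast; ring
      _ ≤ 0 + ε := by rw [zero_add]; exact hk.le
  filter_upwards [measure_eq_zero_iff_ae_notMem.mp hnull] with x hx
  rcases eq_or_ne ‖N x‖ₑ 0 with h0 | h0
  · rw [h0]; exact zero_le
  have hx' : ∃ m₀ : ℤ, ‖N x‖ₑ ≤ rearrangement N ((2 : ℝ) ^ m₀) := by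
    by_contra! hcon
    exact hx hcon
  obtain ⟨m₀, hm₀⟩ := hx'
  obtain ⟨m₁, hm₁⟩ := exists_rearrangement_lt hp' hN (pos_iff_ne_zero.mpr h0)
  obtain ⟨m, hm, hleast⟩ := Int.exists_least_of_bdd
    (P := fun m => rearrangement N ((2 : ℝ) ^ m) < ‖N x‖ₑ)
    ⟨m₀, fun m hm => by
      by_contra! hlt
      exact absurd (lt_of_lt_of_le hm hm₀)
        (not_lt.mpr (rearrangement_anti (zpow_le_zpow_right₀ one_le_two hlt.le)))⟩ ⟨m₁, hm₁⟩
  refine le_trans ?_ (ENNReal.le_tsum (m - 1))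
  rw [indicator_of_mem]
  · by_contra! hlt
    have := hleast _ hlt
    omega
  · apply subset_toMeasurable
    rw [sub_add_cancel]
    exact hm

theorem setLIntegral_enorm_le_sqrt {η : Space n → ℂ} (hη : Measurable η) (E : Set (Space n)) :
    ∫⁻ x in E, ‖η x‖ₑ ≤ volume E ^ (1 / 2 : ℝ) * (∫⁻ x, ‖η x‖ₑ ^ (2 : ℝ)) ^ (1 / 2 : ℝ) := by
  have h := ENNReal.lintegral_mul_le_Lp_mul_Lq (volume.restrict E) Real.HolderConjugate.two_two
    (f := fun _ => 1) (g := fun x => ‖η x‖ₑ) aemeasurable_const hη.enorm.aemeasurable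
  simp only [Pi.mul_apply, one_mul, ENNReal.one_rpow, lintegral_const, Measure.restrict_apply_univ]
    at h
  refine h.trans ?_
  gcongr
  exact Measure.restrict_le_self

/-- On the layer of index m, bound ∫|η| either by the sup bound times the measure or by
Cauchy–Schwarz. Because 1/p + 1/p' = 1, both bounds are 2^{m/p'} times a function of m + l alone. -/
theorem lintegral_enorm_mul_le (hpp : 1 / p + 1 / p' = 1) (hp' : 0 < p') {K : ℝ≥0}
    (hN : ∀ m, lorentzSeq p' N m ≤ K) {η : Space n → ℂ} (hη : Measurable η) {A : ℝ≥0∞} {l : ℤ}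
    (h1 : ∀ x, ‖η x‖ₑ ≤ A * 2 ^ ((l : ℝ) / p))
    (h2 : (∫⁻ x, ‖η x‖ₑ ^ (2 : ℝ)) ^ (1 / 2 : ℝ) ≤ 2 ^ ((l : ℝ) * (1 / p - 1 / 2))) :
    ∫⁻ x, ‖N x‖ₑ * ‖η x‖ₑ ≤ 2 * ∑' m, lorentzSeq p' N m * pairingKernel p A (m + l) := by
  set E : ℤ → Set (Space n) := fun m => toMeasurable volume
      {x | rearrangement N ((2 : ℝ) ^ (m + 1)) < ‖N x‖ₑ} with hE
  have hEm : ∀ m, MeasurableSet (E m) := fun m => measurableSet_toMeasurable _ _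
  have hEv : ∀ m, volume (E m) ≤ 2 * 2 ^ (m : ℝ) := by
    intro m
    rw [hE]
    simp only
    rw [measure_toMeasurable]
    refine (measure_rearrangement_lt_le _ (rearrangement_ne_top (hN _))).trans (le_of_eq ?_)
    nth_rewrite 2 [← ENNReal.rpow_one 2]
    rw [← two_rpow_add]
    congr 1; push_cast; ring
  calc ∫⁻ x, ‖N x‖ₑ * ‖η x‖ₑ
      ≤ ∫⁻ x, ∑' m, (E m).indicator (fun x => rearrangement N ((2 : ℝ) ^ m) * ‖η x‖ₑ) x := by
        refine lintegral_mono_ae ?_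
        filter_upwards [ae_enorm_le_tsum hp' hN] with x hx
        refine (mul_le_mul' hx le_rfl).trans (le_of_eq ?_)
        rw [← ENNReal.tsum_mul_right]
        congr 1 with m
        by_cases hx : x ∈ E m
        · rw [indicator_of_mem hx, indicator_of_mem hx]
        · rw [indicator_of_notMem hx, indicator_of_notMem hx, zero_mul]
    _ = ∑' m, rearrangement N ((2 : ℝ) ^ m) * ∫⁻ x in E m, ‖η x‖ₑ := by
        rw [lintegral_tsum fun m => ((hη.enorm.const_mul _).indicator (hEm m)).aemeasurable]
        congr 1 with m
        rw [lintegral_indicator (hEm m), lintegral_const_mul _ hη.enorm]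
    _ ≤ ∑' m, 2 * (lorentzSeq p' N m * pairingKernel p A (m + l)) := by
        refine ENNReal.tsum_le_tsum fun m => ?_
        have key : ∫⁻ x in E m, ‖η x‖ₑ ≤ 2 * (2 ^ ((m : ℝ) / p') * pairingKernel p A (m + l)) := by
          rw [pairingKernel, mul_min, mul_min]
          refine le_min ?_ ?_
          · calc ∫⁻ x in E m, ‖η x‖ₑ ≤ ∫⁻ _ in E m, A * 2 ^ ((l : ℝ) / p) :=
                  lintegral_mono fun x => h1 x
              _ = A * 2 ^ ((l : ℝ) / p) * volume (E m) := by rw [setLIntegral_const]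
              _ ≤ A * 2 ^ ((l : ℝ) / p) * (2 * 2 ^ (m : ℝ)) := by gcongr; exact hEv m
              _ = 2 * A * (2 ^ ((l : ℝ) / p) * 2 ^ (m : ℝ)) := by ring
              _ = 2 * A * (2 ^ ((m : ℝ) / p') * 2 ^ (((m + l : ℤ) : ℝ) / p)) := by
                  rw [← two_rpow_add, ← two_rpow_add]
                  congr 2
                  have : (m : ℝ) = m * (1 / p + 1 / p') := by rw [hpp, mul_one]
                  push_cast
                  nth_rewrite 1 [this]
                  ring
              _ = _ := by ring
          · calc ∫⁻ x in E m, ‖η x‖ₑ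
                ≤ (2 * 2 ^ (m : ℝ)) ^ (1 / 2 : ℝ) * 2 ^ ((l : ℝ) * (1 / p - 1 / 2)) := by
                  refine (setLIntegral_enorm_le_sqrt hη (E m)).trans ?_
                  gcongr
                  exact hEv m
              _ ≤ 2 * 2 ^ ((m : ℝ) / 2) * 2 ^ ((l : ℝ) * (1 / p - 1 / 2)) := by
                  rw [ENNReal.mul_rpow_of_nonneg _ _ (by norm_num), ← ENNReal.rpow_mul,
                    mul_one_div]
                  gcongr
                  nth_rewrite 2 [← ENNReal.rpow_one 2]
                  exact ENNReal.rpow_le_rpow_of_exponent_le (by norm_num) (by norm_num)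
              _ = _ := by
                  rw [mul_assoc, ← two_rpow_add, ← two_rpow_add]
                  congr 2
                  have : 1 / p' = 1 - 1 / p := by linarith
                  rw [div_eq_mul_one_div (m : ℝ) p', this]
                  push_cast
                  ring
        calc _ ≤ _ := mul_le_mul' le_rfl key
          _ = _ := by rw [lorentzSeq]; ring
    _ = _ := by rw [ENNReal.tsum_mul_left]

end Pairing

/-! ### Lipschitz bound and Hölder inequality for the nonlinearity -/

section Nonlinearity

/-- Bernoulli's inequality for (y/x)^{α+1} gives x^{α+1} - y^{α+1} ≤ (α+1) x^α (x - y), and the left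
side here is at most x^{α+1} - y^{α+1}. Small α needs no separate treatment. -/
theorem rpow_sub_rpow_mul_le {α x y : ℝ} (hα : 0 < α) (hy : 0 ≤ y) (hyx : y ≤ x) :
    (x ^ α - y ^ α) * y ≤ (α + 1) * x ^ α * (x - y) := by
  rcases eq_or_lt_of_le (hy.trans hyx) with hx | hx
  · have : y = 0 := le_antisymm (hx ▸ hyx) hy
    subst this; subst hx; simp
  have h1 := one_add_mul_self_le_rpow_one_add (s := y / x - 1) (p := α + 1)
    (by have : 0 ≤ y / x := by positivity
        linarith) (by linarith)
  rw [add_sub_cancel, Real.div_rpow hy hx.le, Real.rpow_add_one hx.ne', le_div_iff₀ (by positivity)]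
    at h1
  have h2 : (1 + (α + 1) * (y / x - 1)) * (x ^ α * x) =
      x ^ α * x - (α + 1) * x ^ α * (x - y) := by
    field_simp; ring
  rw [h2] at h1
  rcases eq_or_lt_of_le hy with h0 | h0
  · rw [← h0, mul_zero]
    have := sub_nonneg.mpr hyx
    positivity
  rw [Real.rpow_add_one h0.ne'] at h1
  have h3 : x ^ α * y ≤ x ^ α * x := by gcongr
  nlinarith

theorem norm_rpow_mul_sub_le {α : ℝ} (hα : 0 < α) (a c : ℂ) :
    ‖((‖a‖ ^ α : ℝ) : ℂ) * a - ((‖c‖ ^ α : ℝ) : ℂ) * c‖ ≤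
      (α + 2) * (‖a‖ ^ α + ‖c‖ ^ α) * ‖a - c‖ := by
  wlog h : ‖c‖ ≤ ‖a‖ generalizing a c
  · have := this c a (le_of_not_ge h)
    rw [norm_sub_rev, norm_sub_rev a c, add_comm (‖a‖ ^ α)]
    exact this
  have e : ((‖a‖ ^ α : ℝ) : ℂ) * a - ((‖c‖ ^ α : ℝ) : ℂ) * c
      = ((‖a‖ ^ α : ℝ) : ℂ) * (a - c) + ((‖a‖ ^ α - ‖c‖ ^ α : ℝ) : ℂ) * c := by
    push_cast; ring
  have hm : ‖c‖ ^ α ≤ ‖a‖ ^ α := by gcongr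
  rw [e]
  refine (norm_add_le _ _).trans ?_
  rw [norm_mul, norm_mul, Complex.norm_real, Complex.norm_real, Real.norm_of_nonneg (by positivity),
    Real.norm_of_nonneg (sub_nonneg.mpr hm)]
  have h1 := rpow_sub_rpow_mul_le hα (norm_nonneg c) h
  have h2 : (α + 1) * ‖a‖ ^ α * (‖a‖ - ‖c‖) ≤ (α + 1) * ‖a‖ ^ α * ‖a - c‖ := by
    gcongr
    exact norm_sub_norm_le _ _
  have h3 : 0 ≤ (α + 2) * ‖c‖ ^ α * ‖a - c‖ := by positivity
  nlinarith

variable {n : ℕ}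

theorem norm_nonlinearity_sub_le {b α : ℝ} (hα : 0 < α) (u v : Space n → ℂ) (x : Space n) :
    ‖nonlinearity b α u x - nonlinearity b α v x‖ ≤
      (α + 2) * ‖x‖ ^ (-b) * (‖u x‖ ^ α + ‖v x‖ ^ α) * ‖u x - v x‖ := by
  have e : nonlinearity b α u x - nonlinearity b α v x = ((‖x‖ ^ (-b) : ℝ) : ℂ) *
      (((‖u x‖ ^ α : ℝ) : ℂ) * u x - ((‖v x‖ ^ α : ℝ) : ℂ) * v x) := by
    simp only [nonlinearity]; push_cast; ring
  rw [e, norm_mul, Complex.norm_real, Real.norm_of_nonneg (by positivity)]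
  calc _ ≤ ‖x‖ ^ (-b) * ((α + 2) * (‖u x‖ ^ α + ‖v x‖ ^ α) * ‖u x - v x‖) := by
        gcongr
        exact norm_rpow_mul_sub_le hα _ _
    _ = _ := by ring

/-- `|x|^{-b}` belongs to weak `L^{n/b}`. -/
theorem exists_volume_lt_norm_rpow_le (hn : 0 < n) {b : ℝ} (hb : 0 < b) :
    ∃ c : ℝ, 0 < c ∧ ∀ m : ℤ, volume {x : Space n | c * 2 ^ (-(m : ℝ) * b / n) < ‖x‖ ^ (-b)} ≤
      ENNReal.ofReal (2 ^ m) := by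
  have : Nonempty (Fin n) := ⟨⟨0, hn⟩⟩
  set ω : ℝ := (volume (Metric.ball (0 : Space n) 1)).toReal with hω
  have hω0 : 0 < ω := ENNReal.toReal_pos (Metric.measure_ball_pos _ _ one_pos).ne'
    measure_ball_lt_top.ne
  have hn' : (0 : ℝ) < n := by exact_mod_cast hn
  refine ⟨ω ^ (b / n), by positivity, fun m => ?_⟩
  -- The radius of the ball of volume 2^m.
  set ρ : ℝ := ((2 : ℝ) ^ (m : ℝ) / ω) ^ (1 / n : ℝ) with hρ
  have hρ0 : 0 < ρ := by positivity
  have h1 : ω ^ (b / n) * 2 ^ (-(m : ℝ) * b / n) = ρ ^ (-b) := by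
    have e : 1 / (n : ℝ) * -b = -(b / n) := by ring
    rw [hρ, ← Real.rpow_mul (by positivity), e, Real.div_rpow (by positivity) hω0.le,
      ← Real.rpow_mul two_pos.le, Real.rpow_neg hω0.le, div_inv_eq_mul, mul_comm]
    congr 2; ring
  have h2 : {x : Space n | ω ^ (b / n) * 2 ^ (-(m : ℝ) * b / n) < ‖x‖ ^ (-b)} ⊆
      Metric.ball 0 ρ := by
    intro x hx
    rw [mem_ofPred_eq, h1] at hx
    rw [mem_ball_zero_iff]
    by_contra! hcon
    exact absurd hx (not_lt.mpr (Real.rpow_le_rpow_of_nonpos hρ0 hcon (by linarith)))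
  refine (measure_mono h2).trans ?_
  rw [Measure.addHaar_ball _ _ hρ0.le, ← ENNReal.ofReal_toReal measure_ball_lt_top.ne, ← hω,
    ← ENNReal.ofReal_mul (by positivity)]
  apply ENNReal.ofReal_le_ofReal
  apply le_of_eq
  rw [finrank_euclideanSpace, Fintype.card_fin, hρ, ← Real.rpow_natCast, ← Real.rpow_mul (by positivity),
    one_div_mul_cancel hn'.ne', Real.rpow_one, div_mul_cancel₀ _ hω0.ne', Real.rpow_intCast]

/-- Hölder's inequality at the level of rearrangements: off four exceptional sets of measure at most
t each, all factors of the pointwise bound are controlled simultaneously. This explains 4t, and the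
shift by 2 in the dyadic version. -/
theorem rearrangement_nonlinearity_sub_le {b α : ℝ} (hα : 0 < α)
    {u v : Space n → ℂ} {t : ℝ} (ht : 0 ≤ t) {L U V W : ℝ≥0}
    (hL : volume {x : Space n | (L : ℝ) < ‖x‖ ^ (-b)} ≤ ENNReal.ofReal t)
    (hU : rearrangement u t ≤ U) (hV : rearrangement v t ≤ V)
    (hW : rearrangement (fun x => u x - v x) t ≤ W) :
    rearrangement (fun x => nonlinearity b α u x - nonlinearity b α v x) (4 * t) ≤
      (((α + 2).toNNReal * L * (U ^ α + V ^ α) * W : ℝ≥0) : ℝ≥0∞) := by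
  apply rearrangement_le
  have e : ENNReal.ofReal (4 * t) = ENNReal.ofReal t + ENNReal.ofReal t +
      (ENNReal.ofReal t + ENNReal.ofReal t) := by
    rw [← ENNReal.ofReal_add ht ht, ← ENNReal.ofReal_add (by positivity) (by positivity)]
    congr 1; ring
  rw [e]
  refine le_trans (measure_mono (t := ({x : Space n | (L : ℝ) < ‖x‖ ^ (-b)} ∪ {x | U < ‖u x‖₊}) ∪
    ({x | V < ‖v x‖₊} ∪ {x | W < ‖u x - v x‖₊})) ?_)
    ((measure_union_le _ _).trans (add_le_add
      ((measure_union_le _ _).trans (add_le_add hL (distribFun_le_of_rearrangement_le hU)))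
      ((measure_union_le _ _).trans (add_le_add (distribFun_le_of_rearrangement_le hV)
        (distribFun_le_of_rearrangement_le hW)))))
  intro x hx
  by_contra hcon
  simp only [mem_union, mem_ofPred_eq, not_or, not_lt] at hcon hx
  obtain ⟨⟨h1, h2⟩, h3, h4⟩ := hcon
  refine absurd hx (not_lt.mpr ?_)
  rw [← NNReal.coe_le_coe]
  push_cast
  rw [Real.coe_toNNReal _ (by linarith)]
  refine (norm_nonlinearity_sub_le hα u v x).trans ?_
  have h2' : ‖u x‖ ≤ U := h2
  have h3' : ‖v x‖ ≤ V := h3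
  have h4' : ‖u x - v x‖ ≤ W := h4
  have : 0 ≤ α + 2 := by linarith
  gcongr

/-- The exponent identity makes the powers of 2^m cancel: weak L^{n/b} takes b/n, and the α + 1
remaining factors take 1/p each. Only the difference keeps its own sequence; u and v enter through
their weak bounds. -/
theorem lorentzSeq_nonlinearity_sub_le (hn : 0 < n) {b α p p' : ℝ} (hb : 0 < b) (hα : 0 < α)
    (hpp : 1 / p' = b / n + (α + 1) / p) :
    ∃ C : ℝ≥0, ∀ (u v : Space n → ℂ) (K : ℝ≥0), (∀ m, lorentzSeq p u m ≤ K) →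
      (∀ m, lorentzSeq p v m ≤ K) → (∀ m, lorentzSeq p (fun x => u x - v x) m ≠ ∞) →
      ∀ m, lorentzSeq p' (fun x => nonlinearity b α u x - nonlinearity b α v x) (m + 2) ≤
        C * (K : ℝ≥0∞) ^ α * lorentzSeq p (fun x => u x - v x) m := by
  obtain ⟨c, hc0, hc⟩ := exists_volume_lt_norm_rpow_le hn hb
  refine ⟨2 ^ (2 / p') * (α + 2).toNNReal * c.toNNReal * 2, fun u v K hu hv hw m => ?_⟩
  obtain ⟨W', hW'⟩ : ∃ W' : ℝ≥0, (W' : ℝ≥0∞) = lorentzSeq p (fun x => u x - v x) m :=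
    ⟨_, ENNReal.coe_toNNReal (hw m)⟩
  have inv : ∀ {f : Space n → ℂ} {k : ℝ≥0}, lorentzSeq p f m ≤ k →
      rearrangement f ((2 : ℝ) ^ m) ≤ (((2 : ℝ≥0) ^ (-((m : ℝ) / p)) * k : ℝ≥0) : ℝ≥0∞) := by
    intro f k h
    rw [lorentzSeq] at h
    rw [ENNReal.coe_mul, ENNReal.coe_rpow_of_ne_zero two_ne_zero, ENNReal.coe_ofNat]
    calc rearrangement f ((2 : ℝ) ^ m)
        = 2 ^ (-((m : ℝ) / p)) * (2 ^ ((m : ℝ) / p) * rearrangement f ((2 : ℝ) ^ m)) := by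
          rw [← mul_assoc, ← two_rpow_add]; simp
      _ ≤ _ := by gcongr
  have hL := hc m
  have e1 : c * 2 ^ (-(m : ℝ) * b / n) = ((c.toNNReal * 2 ^ (-(m : ℝ) * b / n) : ℝ≥0) : ℝ) := by
    push_cast; rw [Real.coe_toNNReal _ hc0.le]
  rw [e1] at hL
  have h := rearrangement_nonlinearity_sub_le hα (b := b) (by positivity) hL (inv (hu m))
    (inv (hv m)) (inv hW'.ge)
  rw [← hW', lorentzSeq]
  have e2 : (2 : ℝ) ^ (m + 2) = 4 * 2 ^ m := by
    rw [zpow_add₀ two_ne_zero]; norm_num; ring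
  rw [e2]
  refine (mul_le_mul' le_rfl h).trans (le_of_eq ?_)
  have e3 : (2 : ℝ≥0∞) ^ (((m + 2 : ℤ) : ℝ) / p') =
      (((2 : ℝ≥0) ^ (((m + 2 : ℤ) : ℝ) / p') : ℝ≥0) : ℝ≥0∞) := by
    rw [ENNReal.coe_rpow_of_ne_zero two_ne_zero, ENNReal.coe_ofNat]
  rw [e3, ← ENNReal.coe_rpow_of_nonneg _ hα.le, ← ENNReal.coe_mul, ← ENNReal.coe_mul,
    ← ENNReal.coe_mul, ENNReal.coe_inj]
  have e4 : (2 : ℝ≥0) ^ (((m + 2 : ℤ) : ℝ) / p') = 2 ^ (2 / p') *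
      (2 ^ ((m : ℝ) * b / n) * (2 ^ ((m : ℝ) / p * α) * 2 ^ ((m : ℝ) / p))) := by
    rw [← NNReal.rpow_add two_ne_zero, ← NNReal.rpow_add two_ne_zero, ← NNReal.rpow_add two_ne_zero]
    congr 1
    have : ((m + 2 : ℤ) : ℝ) / p' = 2 / p' + m * (1 / p') := by push_cast; ring
    rw [this, hpp]; ring
  have e5 : ∀ x : ℝ, (2 : ℝ≥0) ^ x * 2 ^ (-x) = 1 := fun x => by
    rw [← NNReal.rpow_add two_ne_zero]; simp
  have e6 : -(m : ℝ) * b / n = -((m : ℝ) * b / n) := by ring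
  rw [e4, e6, NNReal.mul_rpow, ← NNReal.rpow_mul]
  have e7 : -((m : ℝ) / p) * α = -((m : ℝ) / p * α) := by ring
  rw [e7]
  calc _ = (2 ^ (2 / p') * (α + 2).toNNReal * c.toNNReal * 2) * K ^ α * W' *
        ((2 ^ ((m : ℝ) * b / n) * 2 ^ (-((m : ℝ) * b / n))) *
        (2 ^ ((m : ℝ) / p * α) * 2 ^ (-((m : ℝ) / p * α))) *
        (2 ^ ((m : ℝ) / p) * 2 ^ (-((m : ℝ) / p)))) := by ring
    _ = _ := by rw [e5, e5, e5]; ring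

end Nonlinearity

/-! ### The dispersive estimate in Lorentz spaces, tested -/

section Dispersive

variable {n : ℕ} {p p' : ℝ}

theorem lintegral_enorm_sq_eq (ψ : 𝓢(Space n, ℂ)) :
    ∫⁻ x, ‖ψ x‖ₑ ^ (2 : ℝ) = ENNReal.ofReal (∫ x, ‖ψ x‖ ^ 2) := by
  rw [ofReal_integral_eq_lintegral_ofReal]
  · congr 1 with x
    rw [← ofReal_norm, ENNReal.ofReal_rpow_of_nonneg (norm_nonneg _) (by norm_num)]
    norm_num
  · exact (ψ.memLp 2).integrable_norm_pow (by norm_num)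
  · exact Eventually.of_forall fun x => by positivity

/-- A test function which is normalised in `L¹` and `L²` like a function of size `2^{-l/p'}` on a
set of measure `2^l`, where `1/p + 1/p' = 1`. -/
def IsDyadicAtom (p : ℝ) (l : ℤ) (ψ : 𝓢(Space n, ℂ)) : Prop :=
  ∫ x, ‖ψ x‖ ≤ 2 ^ ((l : ℝ) / p) ∧ ∫ x, ‖ψ x‖ ^ 2 ≤ (2 ^ ((l : ℝ) * (1 / p - 1 / 2))) ^ 2

theorem lintegral_enorm_mul_testFlow_le (hpp : 1 / p + 1 / p' = 1) (hp' : 0 < p')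
    {N : Space n → ℂ} {K : ℝ≥0} (hN : ∀ m, lorentzSeq p' N m ≤ K) {s : ℝ} (hs : 0 < s) {l : ℤ}
    {ψ : 𝓢(Space n, ℂ)} (hψ : IsDyadicAtom p l ψ) :
    ∫⁻ x, ‖N x‖ₑ * ‖testFlow s ψ x‖ₑ ≤ 2 * ∑' m, lorentzSeq p' N m *
      pairingKernel p (ENNReal.ofReal (s ^ (-(n : ℝ) / 2))) (m + l) := by
  have e : ∀ x : ℝ, (2 : ℝ≥0∞) ^ x = ENNReal.ofReal (2 ^ x) := fun x => by
    rw [← ENNReal.ofReal_rpow_of_pos two_pos]; simp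
  apply lintegral_enorm_mul_le hpp hp' hN (testFlow s ψ).continuous.measurable
  · intro x
    rw [e, ← ENNReal.ofReal_mul (by positivity), ← ofReal_norm]
    apply ENNReal.ofReal_le_ofReal
    refine (norm_testFlow_le hs ψ x).trans ?_
    gcongr
    exact hψ.1
  · rw [lintegral_enorm_sq_eq, integral_norm_sq_testFlow, e,
      ENNReal.ofReal_rpow_of_nonneg (by positivity) (by norm_num)]
    apply ENNReal.ofReal_le_ofReal
    rw [← Real.sqrt_eq_rpow, Real.sqrt_le_left (by positivity)]
    exact hψ.2

/-- Real interpolation by hand. For a fixed product scale j = m + l, the sum over l pairs z with a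
reflected translate of the sequence of N, so Hölder's inequality in ℓ^q bounds it uniformly in j;
the kernel then sums over j to s^{-κ}. -/
theorem enorm_integral_mul_testFlow_le (hp : 2 < p) (hpp : 1 / p + 1 / p' = 1)
    {q : ℝ≥0∞} (hq : 1 < q) :
    ∃ C : ℝ≥0, ∀ (N : Space n → ℂ) (s : ℝ), AEStronglyMeasurable N volume → 0 < s →
      seqNorm q (lorentzSeq p' N) ≠ ∞ →
      ∀ (S : Finset ℤ) (z : ℤ → ℝ≥0) (ψ : ℤ → 𝓢(Space n, ℂ)), (∀ l ∈ S, IsDyadicAtom p l (ψ l)) →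
      ‖∫ x, N x * testFlow s (∑ l ∈ S, (z l : ℂ) • ψ l) x‖ₑ ≤
        C * ENNReal.ofReal (s ^ (-((n : ℝ) / 2 * (1 / p' - 1 / p)))) *
          (dualNorm q S (fun l => z l) * seqNorm q (lorentzSeq p' N)) := by
  obtain ⟨C, hC⟩ := tsum_pairingKernel_le hp
  have hp0 : 0 < p := by linarith
  have hp' : 0 < p' := by
    have : 0 < 1 / p' := by
      have : 1 / p < 1 := by rw [div_lt_one hp0]; linarith
      linarith
    exact one_div_pos.mp this
  refine ⟨2 * C, fun N s hNm hs hN S z ψ hψ => ?_⟩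
  have hq0 : q ≠ 0 := (zero_lt_one.trans hq).ne'
  have hNK : ∀ m, lorentzSeq p' N m ≤ (seqNorm q (lorentzSeq p' N)).toNNReal := fun m => by
    rw [ENNReal.coe_toNNReal hN]; exact le_seqNorm hq0 m
  set A := ENNReal.ofReal (s ^ (-(n : ℝ) / 2)) with hA
  calc ‖∫ x, N x * testFlow s (∑ l ∈ S, (z l : ℂ) • ψ l) x‖ₑ
      ≤ ∫⁻ x, ‖N x * testFlow s (∑ l ∈ S, (z l : ℂ) • ψ l) x‖ₑ := enorm_integral_le_lintegral_enorm _
    _ ≤ ∑ l ∈ S, z l * ∫⁻ x, ‖N x‖ₑ * ‖testFlow s (ψ l) x‖ₑ := by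
        have hm : ∀ l ∈ S, AEMeasurable
            (fun x => (z l : ℝ≥0∞) * (‖N x‖ₑ * ‖testFlow s (ψ l) x‖ₑ)) := fun l _ =>
          (hNm.enorm.mul (testFlow s (ψ l)).continuous.measurable.enorm.aemeasurable).const_mul _
        rw [← Finset.sum_congr rfl fun l _ => lintegral_const_mul' (z l : ℝ≥0∞)
          (fun x => ‖N x‖ₑ * ‖testFlow s (ψ l) x‖ₑ) ENNReal.coe_ne_top, ← lintegral_finsetSum' _ hm]
        refine lintegral_mono fun x => ?_
        simp only [map_sum, map_smul]
        rw [enorm_mul, sum_apply]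
        refine (mul_le_mul' le_rfl (enorm_sum_le _ _)).trans (le_of_eq ?_)
        rw [Finset.mul_sum]
        refine Finset.sum_congr rfl fun l _ => ?_
        rw [smul_apply, enorm_smul]
        have : ‖(z l : ℂ)‖ₑ = z l := by
          rw [← ofReal_norm]
          simp
        rw [this]
        ring
    _ ≤ ∑ l ∈ S, z l * (2 * ∑' m, lorentzSeq p' N m * pairingKernel p A (m + l)) := by
        gcongr with l hl
        exact lintegral_enorm_mul_testFlow_le hpp hp' hNK hs (hψ l hl)
    _ = ∑ l ∈ S, z l * (2 * ∑' j, lorentzSeq p' N (j - l) * pairingKernel p A j) := by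
        congr 1 with l
        congr 2
        rw [← (Equiv.subRight l).tsum_eq (fun m => lorentzSeq p' N m * pairingKernel p A (m + l))]
        simp
    _ = 2 * ∑' j, pairingKernel p A j * ∑ l ∈ S, z l * lorentzSeq p' N (j - l) := by
        simp_rw [Finset.mul_sum]
        rw [Summable.tsum_finsetSum fun _ _ => ENNReal.summable, Finset.mul_sum]
        congr 1 with l
        simp_rw [← ENNReal.tsum_mul_left]
        congr 1 with j
        ring
    _ ≤ 2 * ∑' j, pairingKernel p A j *
          (dualNorm q S (fun l => z l) * seqNorm q (lorentzSeq p' N)) := by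
        gcongr with j
        exact sum_mul_le_dualNorm_mul_seqNorm hq S _ sub_right_injective
    _ ≤ _ := by
        rw [ENNReal.tsum_mul_right, ← mul_assoc, ENNReal.coe_mul, ENNReal.coe_ofNat, mul_assoc 2 (C : ℝ≥0∞)]
        refine mul_le_mul' (mul_le_mul' le_rfl ?_) le_rfl
        refine (hC _ (by positivity)).trans (le_of_eq ?_)
        rw [← Real.rpow_mul hs.le]
        congr 3
        have : 1 / p' = 1 - 1 / p := by linarith
        rw [this]; ring

end Dispersive

/-! ### Recovering the Lorentz norm by testing -/

section Testing

variable {n : ℕ}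

/-- Test with a bump function equal to 1 on a ball. -/
theorem locallyIntegrable_of_integrable_mul_schwartz {g : Space n → ℂ}
    (hg : ∀ ψ : 𝓢(Space n, ℂ), Integrable (fun x => g x * ψ x)) : LocallyIntegrable g volume := by
  intro x
  let φ : ContDiffBump x := ⟨1, 2, one_pos, one_lt_two⟩
  have hc : HasCompactSupport (fun y => (φ y : ℂ)) :=
    φ.hasCompactSupport.comp_left (g := fun t : ℝ => (t : ℂ)) (by simp)
  have hd : ContDiff ℝ (⊤ : ℕ∞) (fun y => (φ y : ℂ)) :=
    Complex.ofRealCLM.contDiff.comp φ.contDiff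
  refine ⟨Metric.closedBall x 1, Metric.closedBall_mem_nhds x one_pos, ?_⟩
  refine ((hg (hc.toSchwartzMap hd)).integrableOn (s := Metric.closedBall x 1)).congr_fun
    (fun y hy => ?_) measurableSet_closedBall
  change g y * (φ y : ℂ) = g y
  rw [φ.one_of_mem_closedBall hy, Complex.ofReal_one, mul_one]

open scoped Convolution in
-- Mollify f: the approximations inherit the bound B and live in a slightly larger ball, so a.e.
-- convergence passes to all three integrals by domination.
theorem exists_schwartz_tendsto {f g : Space n → ℂ} {B R : ℝ}
    (hf : AEStronglyMeasurable f volume) (hB : ∀ x, ‖f x‖ ≤ B)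
    (hsupp : ∀ x, x ∉ Metric.ball (0 : Space n) R → f x = 0) (hg : LocallyIntegrable g volume) :
    ∃ ψ : ℕ → 𝓢(Space n, ℂ),
      Tendsto (fun k => ∫ x, ‖ψ k x‖) atTop (𝓝 (∫ x, ‖f x‖)) ∧
      Tendsto (fun k => ∫ x, ‖ψ k x‖ ^ 2) atTop (𝓝 (∫ x, ‖f x‖ ^ 2)) ∧
      Tendsto (fun k => ∫ x, g x * ψ k x) atTop (𝓝 (∫ x, g x * f x)) := by
  have hB0 : 0 ≤ B := (norm_nonneg _).trans (hB 0)
  have hind : ∀ {h : ℝ}, Integrable ((Metric.ball (0 : Space n) (R + 1)).indicator fun _ => h) :=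
    (integrable_indicator_iff measurableSet_ball).mpr
      (integrableOn_const measure_ball_lt_top.ne)
  have hfi : Integrable f := by
    refine (hind (h := B)).mono' hf (Eventually.of_forall fun x => ?_)
    by_cases hx : x ∈ Metric.ball (0 : Space n) R
    · rw [indicator_of_mem (Metric.ball_subset_ball (by linarith) hx)]; exact hB x
    · rw [hsupp x hx, norm_zero]; exact indicator_nonneg (fun _ _ => hB0) _
  -- The radius ratio 2 is what the a.e. convergence of the mollifications uses; an outer radius of
  -- at most 1 keeps all supports in the ball of radius R + 1.
  let φ : ℕ → ContDiffBump (0 : Space n) := fun k =>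
    ⟨1 / (2 * ((k : ℝ) + 1)), 1 / ((k : ℝ) + 1), by positivity, by
      apply one_div_lt_one_div_of_lt <;> linarith [(Nat.cast_nonneg k : (0 : ℝ) ≤ k)]⟩
  set F : ℕ → Space n → ℂ := fun k =>
    ((φ k).normed volume ⋆[ContinuousLinearMap.lsmul ℝ ℝ, volume] f : Space n → ℂ) with hF
  have hout : ∀ k, (φ k).rOut ≤ 1 := fun k => by
    change 1 / ((k : ℝ) + 1) ≤ 1
    rw [div_le_one (by positivity)]
    linarith [(Nat.cast_nonneg k : (0 : ℝ) ≤ k)]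
  have hFB : ∀ k x, ‖F k x‖ ≤ B := by
    intro k x
    rw [← dist_zero_right]
    exact dist_convolution_le hB0 (φ k).support_normed_eq.subset (φ k).nonneg_normed
      (φ k).integral_normed hf (fun y _ => by rw [dist_zero_right]; exact hB y)
  have hF0 : ∀ k x, x ∉ Metric.ball (0 : Space n) (R + 1) → F k x = 0 := by
    intro k x hx
    rw [← dist_le_zero]
    refine dist_convolution_le le_rfl (φ k).support_normed_eq.subset (φ k).nonneg_normed
      (φ k).integral_normed hf (fun y hy => ?_)
    rw [dist_le_zero]
    apply hsupp
    intro hy'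
    rw [mem_ball_zero_iff] at hx hy'
    rw [mem_ball_iff_norm'] at hy
    have := norm_le_norm_add_norm_sub y x
    have h3 := hout k
    rw [norm_sub_rev] at this
    linarith
  have hdom : ∀ k x, ‖F k x‖ ≤ (Metric.ball (0 : Space n) (R + 1)).indicator (fun _ => B) x := by
    intro k x
    by_cases hx : x ∈ Metric.ball (0 : Space n) (R + 1)
    · rw [indicator_of_mem hx]; exact hFB k x
    · rw [indicator_of_notMem hx, hF0 k x hx, norm_zero]
  have hFc : ∀ k, HasCompactSupport (F k) := fun k =>
    HasCompactSupport.intro (isCompact_closedBall (0 : Space n) (R + 1)) fun x hx =>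
      hF0 k x fun h => hx (Metric.ball_subset_closedBall h)
  have hFd : ∀ k, ContDiff ℝ (⊤ : ℕ∞) (F k) := fun k =>
    (φ k).hasCompactSupport_normed.contDiff_convolution_left _ (φ k).contDiff_normed
      hfi.locallyIntegrable
  have hlim : ∀ᵐ x, Tendsto (fun k => F k x) atTop (𝓝 (f x)) := by
    refine ContDiffBump.ae_convolution_tendsto_right_of_locallyIntegrable (K := 2) ?_ ?_
      hfi.locallyIntegrable
    · exact tendsto_one_div_add_atTop_nhds_zero_nat
    · refine Eventually.of_forall fun k => ?_
      change 1 / ((k : ℝ) + 1) ≤ 2 * (1 / (2 * ((k : ℝ) + 1)))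
      apply le_of_eq; field_simp
  have hFm : ∀ k, AEStronglyMeasurable (F k) volume := fun k =>
    (hFd k).continuous.aestronglyMeasurable
  refine ⟨fun k => (hFc k).toSchwartzMap (hFd k), ?_, ?_, ?_⟩
  · change Tendsto (fun k => ∫ x, ‖F k x‖) atTop _
    refine tendsto_integral_of_dominated_convergence _ (fun k => (hFm k).norm) (hind (h := B))
      (fun k => Eventually.of_forall fun x => ?_) (hlim.mono fun x hx => hx.norm)
    rw [norm_norm]; exact hdom k x
  · change Tendsto (fun k => ∫ x, ‖F k x‖ ^ 2) atTop _
    refine tendsto_integral_of_dominated_convergence _ (fun k => (hFm k).norm.pow 2)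
      (hind (h := B ^ 2)) (fun k => Eventually.of_forall fun x => ?_)
      (hlim.mono fun x hx => hx.norm.pow 2)
    rw [norm_pow, norm_norm]
    by_cases hx : x ∈ Metric.ball (0 : Space n) (R + 1)
    · rw [indicator_of_mem hx]; gcongr; exact hFB k x
    · rw [indicator_of_notMem hx, hF0 k x hx, norm_zero]; norm_num
  · change Tendsto (fun k => ∫ x, g x * F k x) atTop _
    have hgi : Integrable ((Metric.ball (0 : Space n) (R + 1)).indicator fun x => ‖g x‖ * B) := by
      rw [integrable_indicator_iff measurableSet_ball]
      exact (((hg.integrableOn_isCompact (isCompact_closedBall (0 : Space n) (R + 1))).mono_set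
        Metric.ball_subset_closedBall).norm).mul_const B
    refine tendsto_integral_of_dominated_convergence _
      (fun k => hg.aestronglyMeasurable.mul (hFm k)) hgi
      (fun k => Eventually.of_forall fun x => ?_)
      (hlim.mono fun x hx => hx.const_mul (g x))
    rw [norm_mul]
    by_cases hx : x ∈ Metric.ball (0 : Space n) (R + 1)
    · rw [indicator_of_mem hx]; gcongr; exact hFB k x
    · rw [indicator_of_notMem hx, hF0 k x hx, norm_zero, mul_zero]

theorem exists_schwartz_le_re_integral {g : Space n → ℂ} (hg : LocallyIntegrable g volume)
    {s : ℝ} (hs : 0 < s) {lam : ℝ≥0} (hlam : 0 < lam)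
    (h : ENNReal.ofReal s < distribFun g lam) :
    ∃ ψ : 𝓢(Space n, ℂ), ∫ x, ‖ψ x‖ ≤ 1 ∧ ∫ x, ‖ψ x‖ ^ 2 ≤ 1 / s ∧
      (lam : ℝ) / 4 ≤ (∫ x, g x * ψ x).re := by
  obtain ⟨g', hg'm, hgg'⟩ := hg.aestronglyMeasurable
  have hFm : ∀ k : ℕ, MeasurableSet ({x | lam < ‖g' x‖₊} ∩ Metric.ball 0 k) := fun k =>
    (measurableSet_lt measurable_const hg'm.measurable.nnnorm).inter measurableSet_ball
  obtain ⟨k, hk⟩ : ∃ k : ℕ, ENNReal.ofReal s < volume ({x | lam < ‖g' x‖₊} ∩ Metric.ball 0 k) := by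
    by_contra! hcon
    refine absurd h (not_lt.mpr ?_)
    have e1 : distribFun g lam = volume {x | lam < ‖g' x‖₊} := by
      apply measure_congr
      filter_upwards [hgg'] with x hx
      change (lam < ‖g x‖₊) = (lam < ‖g' x‖₊)
      rw [hx]
    have hmono : Monotone fun k : ℕ => {x | lam < ‖g' x‖₊} ∩ Metric.ball (0 : Space n) k := by
      intro i j hij
      exact inter_subset_inter_right _ (Metric.ball_subset_ball (by exact_mod_cast hij))
    rw [e1, ← inter_univ {x | lam < ‖g' x‖₊}, ← Metric.iUnion_ball_nat (0 : Space n),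
      inter_iUnion, hmono.measure_iUnion]
    exact iSup_le hcon
  set F : Set (Space n) := {x | lam < ‖g' x‖₊} ∩ Metric.ball 0 k with hF
  have hFsub : F ⊆ Metric.ball 0 k := inter_subset_right
  have hFlam : ∀ x ∈ F, (lam : ℝ) < ‖g' x‖ := fun x hx => NNReal.coe_lt_coe.mpr hx.1
  have hFfin : volume F ≠ ∞ := ((measure_mono hFsub).trans_lt measure_ball_lt_top).ne
  set μ : ℝ := (volume F).toReal with hμ
  have hsμ : s < μ := (ENNReal.ofReal_lt_iff_lt_toReal hs.le hFfin).mp hk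
  have hμ0 : 0 < μ := hs.trans hsμ
  -- The conjugate phase of g on a bounded part of the superlevel set, with L¹ norm 1/2 rather than
  -- 1: all three desired inequalities are then strict and survive the approximation by Schwartz
  -- functions.
  set f : Space n → ℂ := F.indicator fun x => (2 * μ : ℂ)⁻¹ * ((starRingEnd ℂ) (g' x) / ‖g' x‖)
    with hf
  have hfn : ∀ x, ‖f x‖ = F.indicator (fun _ => (2 * μ)⁻¹) x := by
    intro x
    by_cases hx : x ∈ F
    · rw [hf, indicator_of_mem hx, indicator_of_mem hx]
      have : ‖g' x‖ ≠ 0 := (lt_of_le_of_lt lam.2 (hFlam x hx)).ne'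
      simp [this, abs_of_pos hμ0]
    · rw [hf, indicator_of_notMem hx, indicator_of_notMem hx, norm_zero]
  have hfm : AEStronglyMeasurable f volume := by
    refine (Measurable.indicator ?_ (hFm k)).aestronglyMeasurable
    have := hg'm.measurable
    exact measurable_const.mul ((Complex.continuous_conj.measurable.comp this).div
      (Complex.measurable_ofReal.comp this.norm))
  obtain ⟨ψ, h1, h2, h3⟩ := exists_schwartz_tendsto (f := f) (g := g) (B := (2 * μ)⁻¹)
    (R := k) hfm
    (fun x => by
      rw [hfn]
      exact indicator_le_self' (fun _ _ => by positivity) x)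
    (fun x hx => indicator_of_notMem (fun hxF => hx (hFsub hxF)) _) hg
  have i1 : ∫ x, ‖f x‖ = 1 / 2 := by
    simp_rw [hfn]
    rw [integral_indicator (hFm k), setIntegral_const, smul_eq_mul, Measure.real, ← hμ]
    field_simp
  have i2 : ∫ x, ‖f x‖ ^ 2 < 1 / s := by
    have e : ∀ x, ‖f x‖ ^ 2 = F.indicator (fun _ => ((2 * μ)⁻¹) ^ 2) x := by
      intro x
      rw [hfn]
      by_cases hx : x ∈ F
      · rw [indicator_of_mem hx, indicator_of_mem hx]
      · rw [indicator_of_notMem hx, indicator_of_notMem hx]; norm_num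
    simp_rw [e]
    rw [integral_indicator (hFm k), setIntegral_const, smul_eq_mul, Measure.real, ← hμ]
    have : μ * (2 * μ)⁻¹ ^ 2 = 1 / (4 * μ) := by field_simp; norm_num
    rw [this]
    exact one_div_lt_one_div_of_lt hs (by linarith)
  have i3 : (lam : ℝ) / 4 < (∫ x, g x * f x).re := by
    have e : ∫ x, g x * f x = ((∫ x in F, (2 * μ)⁻¹ * ‖g x‖ : ℝ) : ℂ) := by
      rw [← integral_complex_ofReal, ← integral_indicator (hFm k)]
      apply integral_congr_ae
      filter_upwards [hgg'] with x hx
      by_cases hxF : x ∈ F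
      · rw [hf, indicator_of_mem hxF, indicator_of_mem hxF, ← hx]
        have h0 : (‖g x‖ : ℂ) ≠ 0 := by
          rw [hx]
          exact_mod_cast (lt_of_le_of_lt lam.2 (hFlam x hxF)).ne'
        have hmul : g x * (starRingEnd ℂ) (g x) = (‖g x‖ : ℂ) ^ 2 := Complex.mul_conj' _
        push_cast
        calc _ = (2 * (μ : ℂ))⁻¹ * (g x * (starRingEnd ℂ) (g x)) / ‖g x‖ := by ring
          _ = _ := by rw [hmul]; field_simp
      · rw [hf, indicator_of_notMem hxF, indicator_of_notMem hxF, mul_zero]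
    rw [e, Complex.ofReal_re]
    have hgF : IntegrableOn g F :=
      (hg.integrableOn_isCompact (isCompact_closedBall (0 : Space n) k)).mono_set
        (hFsub.trans Metric.ball_subset_closedBall)
    calc (lam : ℝ) / 4 < lam / 2 := by
          have : (0 : ℝ) < lam := hlam
          linarith
      _ = ∫ x in F, (2 * μ)⁻¹ * (lam : ℝ) := by
          rw [setIntegral_const, smul_eq_mul, Measure.real, ← hμ]
          field_simp
      _ ≤ _ := by
          refine setIntegral_mono_on_ae (integrableOn_const hFfin) (hgF.norm.const_mul _) (hFm k) ?_
          filter_upwards [hgg'] with x hx hxF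
          rw [hx]
          gcongr
          exact (hFlam x hxF).le
  have h3' := (Complex.continuous_re.tendsto _).comp h3
  obtain ⟨j, j1, j2, j3⟩ := ((h1.eventually_lt_const (by rw [i1]; norm_num : _ < (1 : ℝ))).and
    ((h2.eventually_lt_const i2).and (h3'.eventually_const_lt i3))).exists
  exact ⟨ψ j, j1.le, j2.le, j3.le⟩

/-- The previous test function at measure 2^l, multiplied by 2^{l/p}. The alternative θ = 0, served
by ψ = 0, covers vanishing entries of the sequence. -/
theorem exists_isDyadicAtom_le_re_integral {g : Space n → ℂ} (hg : LocallyIntegrable g volume)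
    {p : ℝ} {l : ℤ} {θ : ℝ≥0} (h : θ < lorentzSeq p g l ∨ θ = 0) :
    ∃ ψ : 𝓢(Space n, ℂ), IsDyadicAtom p l ψ ∧ (θ : ℝ) / 4 ≤ (∫ x, g x * ψ x).re := by
  rcases eq_or_ne θ 0 with rfl | hθ
  · refine ⟨0, ⟨?_, ?_⟩, ?_⟩
    · simp; positivity
    · simp; positivity
    · simp
  have h := h.resolve_right hθ
  set lam : ℝ≥0 := (2 : ℝ≥0) ^ (-((l : ℝ) / p)) * θ with hlam
  have hlt : (lam : ℝ≥0∞) < rearrangement g ((2 : ℝ) ^ l) := by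
    by_contra! hcon
    refine absurd h (not_lt.mpr ?_)
    rw [lorentzSeq]
    calc _ ≤ (2 : ℝ≥0∞) ^ ((l : ℝ) / p) * lam := by gcongr
      _ = θ := by
        rw [hlam, ENNReal.coe_mul, ENNReal.coe_rpow_of_ne_zero two_ne_zero, ENNReal.coe_ofNat,
          ← mul_assoc, ← two_rpow_add]
        simp
  obtain ⟨ψ, h1, h2, h3⟩ := exists_schwartz_le_re_integral hg (s := (2 : ℝ) ^ l) (by positivity)
    (lam := lam) (by positivity) (lt_distribFun_of_lt_rearrangement hlt)
  set c : ℝ := (2 : ℝ) ^ ((l : ℝ) / p) with hc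
  have hc0 : 0 < c := by positivity
  refine ⟨(c : ℂ) • ψ, ⟨?_, ?_⟩, ?_⟩
  · simp only [smul_apply, norm_smul, Complex.norm_real, Real.norm_of_nonneg hc0.le]
    rw [integral_const_mul]
    nlinarith
  · simp only [smul_apply, norm_smul, Complex.norm_real, Real.norm_of_nonneg hc0.le, mul_pow]
    rw [integral_const_mul]
    calc c ^ 2 * ∫ x, ‖ψ x‖ ^ 2 ≤ c ^ 2 * (1 / 2 ^ l) := by gcongr
      _ = _ := by
        rw [hc, ← Real.rpow_natCast, ← Real.rpow_natCast, ← Real.rpow_mul two_pos.le,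
          ← Real.rpow_mul two_pos.le, ← Real.rpow_intCast, one_div, ← Real.rpow_neg two_pos.le,
          ← Real.rpow_add two_pos]
        congr 1; push_cast; ring
  · have e : ∫ x, g x * ((c : ℂ) • ψ) x = (c : ℂ) * ∫ x, g x * ψ x := by
      rw [← integral_const_mul]
      congr 1 with x
      simp only [smul_apply, smul_eq_mul]
      ring
    rw [e, Complex.re_ofReal_mul]
    calc (θ : ℝ) / 4 = c * (lam / 4) := by
          rw [hlam, hc]; push_cast
          have : (2 : ℝ) ^ ((l : ℝ) / p) * 2 ^ (-((l : ℝ) / p)) = 1 := by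
            rw [← Real.rpow_add two_pos]; simp
          linear_combination -(θ : ℝ) / 4 * this
      _ ≤ _ := by gcongr

/-- Duality of ℓ^q: atoms that almost norm each entry turn the pairing bound into a bound for Σ z_l
θ_l. The factor 8 is 4 from the atoms times 2 from the slack in θ. -/
theorem seqNorm_le_of_forall_pairing {g : Space n → ℂ}
    (hg : ∀ ψ : 𝓢(Space n, ℂ), Integrable (fun x => g x * ψ x)) {p : ℝ} {q : ℝ≥0∞} (hq : 1 < q)
    {A : ℝ≥0} (h : ∀ (S : Finset ℤ) (z : ℤ → ℝ≥0) (ψ : ℤ → 𝓢(Space n, ℂ)),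
      (∀ l ∈ S, IsDyadicAtom p l (ψ l)) →
      ‖∫ x, g x * (∑ l ∈ S, (z l : ℂ) • ψ l) x‖ₑ ≤ A * dualNorm q S (fun l => z l)) :
    seqNorm q (lorentzSeq p g) ≤ 8 * A := by
  have hq0 : q ≠ 0 := (zero_lt_one.trans hq).ne'
  have hloc := locallyIntegrable_of_integrable_mul_schwartz hg
  have key : ∀ θ : ℤ → ℝ≥0, (∀ l, θ l < lorentzSeq p g l ∨ θ l = 0) → ∀ (S : Finset ℤ)
      (z : ℤ → ℝ≥0), ∑ l ∈ S, (z l : ℝ≥0∞) * θ l ≤ 4 * A * dualNorm q S (fun l => z l) := by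
    intro θ hθ S z
    choose ψ hψ hre using fun l => exists_isDyadicAtom_le_re_integral hloc (hθ l)
    have e : ∫ x, g x * (∑ l ∈ S, (z l : ℂ) • ψ l) x = ∑ l ∈ S, (z l : ℂ) * ∫ x, g x * ψ l x := by
      simp_rw [← integral_const_mul]
      rw [← integral_finsetSum _ fun l _ => (hg (ψ l)).const_mul _]
      congr 1 with x
      rw [sum_apply, Finset.mul_sum]
      refine Finset.sum_congr rfl fun l _ => ?_
      simp only [smul_apply, smul_eq_mul]
      ring
    have h1 : ∑ l ∈ S, (z l : ℝ) * θ l ≤ 4 * ‖∫ x, g x * (∑ l ∈ S, (z l : ℂ) • ψ l) x‖ := by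
      refine le_trans ?_ (mul_le_mul_of_nonneg_left (Complex.re_le_norm _) (by norm_num))
      rw [e, Complex.re_sum, Finset.mul_sum]
      refine Finset.sum_le_sum fun l _ => ?_
      have : ((z l : ℂ) * ∫ x, g x * ψ l x).re = (z l : ℝ) * (∫ x, g x * ψ l x).re :=
        Complex.re_ofReal_mul _ _
      rw [this]
      have := mul_le_mul_of_nonneg_left (hre l) (NNReal.coe_nonneg (z l))
      linarith
    have h2 : ((∑ l ∈ S, z l * θ l : ℝ≥0) : ℝ≥0∞) ≤
        4 * ‖∫ x, g x * (∑ l ∈ S, (z l : ℂ) • ψ l) x‖ₑ := by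
      rw [enorm_eq_nnnorm, ← ENNReal.coe_ofNat, ← ENNReal.coe_mul, ENNReal.coe_le_coe,
        ← NNReal.coe_le_coe]
      simpa only [NNReal.coe_sum, NNReal.coe_mul, coe_nnnorm, NNReal.coe_ofNat] using h1
    simp only [ENNReal.ofNNReal_finsetSum, ENNReal.coe_mul] at h2
    refine h2.trans ?_
    rw [mul_assoc]
    gcongr
    exact h S z ψ fun l _ => hψ l
  have hle : ∀ l, lorentzSeq p g l ≤ 4 * A := by
    intro l
    refine ENNReal.le_of_forall_nnreal_lt fun t ht => ?_
    have := key (fun j => if j = l then t else 0) (fun j => by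
      by_cases hj : j = l
      · subst hj; simp [ht]
      · simp [hj]) {l} (fun _ => 1)
    refine (le_of_eq_of_le (by simp) this).trans (le_of_eq ?_)
    rw [dualNorm]
    split_ifs <;> simp
  rcases eq_or_ne q ∞ with rfl | hqt
  · rw [seqNorm, if_pos rfl]
    refine iSup_le fun l => (hle l).trans ?_
    gcongr
    norm_num
  have hfin : ∀ l, lorentzSeq p g l ≠ ∞ := fun l =>
    ne_top_of_le_ne_top (ENNReal.mul_ne_top (by simp) ENNReal.coe_ne_top) (hle l)
  -- Half of each entry, to lie strictly below it whenever it is nonzero.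
  set θ : ℤ → ℝ≥0 := fun l => (lorentzSeq p g l).toNNReal / 2 with hθ
  have hx : lorentzSeq p g = fun l => 2 * (θ l : ℝ≥0∞) := by
    ext l
    rw [hθ]
    simp only
    rw [← ENNReal.coe_ofNat, ← ENNReal.coe_mul, mul_div_cancel₀ _ two_ne_zero,
      ENNReal.coe_toNNReal (hfin l)]
  have hθlt : ∀ l, θ l < lorentzSeq p g l ∨ θ l = 0 := by
    intro l
    rcases eq_or_ne (θ l) 0 with h0 | h0
    · exact Or.inr h0
    · left
      rw [hx]
      change (θ l : ℝ≥0∞) < 2 * θ l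
      rw [two_mul, ← ENNReal.coe_add, ENNReal.coe_lt_coe]
      exact lt_add_of_pos_right _ (pos_iff_ne_zero.mpr h0)
  have hq1 : 1 < q.toReal := by
    rw [← ENNReal.toReal_one]
    exact (ENNReal.toReal_lt_toReal ENNReal.one_ne_top hqt).mpr hq
  have hconj := Real.HolderConjugate.conjExponent hq1
  have hS : ∀ S : Finset ℤ, ∑ l ∈ S, (θ l : ℝ≥0∞) ^ q.toReal ≤ (4 * A) ^ q.toReal := by
    intro S
    -- The extremal coefficients z = θ^{q-1} give T ≤ 4A T^{1/q'}; the finite partial sum T may be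
    -- divided out.
    have h1 := key θ hθlt S (fun l => θ l ^ (q.toReal - 1))
    rw [dualNorm, if_neg hqt] at h1
    have e1 : ∀ l, ((θ l ^ (q.toReal - 1) : ℝ≥0) : ℝ≥0∞) * θ l = (θ l : ℝ≥0∞) ^ q.toReal := by
      intro l
      rw [← ENNReal.coe_rpow_of_nonneg _ (by linarith), ← ENNReal.coe_mul, ENNReal.coe_inj]
      conv_lhs => rw [← NNReal.rpow_one (θ l), ← NNReal.rpow_mul]
      rw [← NNReal.rpow_add_of_nonneg _ (by linarith) zero_le_one]
      congr 1; ring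
    have e2 : ∀ l, ((θ l ^ (q.toReal - 1) : ℝ≥0) : ℝ≥0∞) ^ q.toReal.conjExponent =
        (θ l : ℝ≥0∞) ^ q.toReal := by
      intro l
      rw [ENNReal.coe_rpow_of_nonneg _ (by linarith), ← ENNReal.rpow_mul]
      congr 1
      exact hconj.sub_one_mul_conj
    simp_rw [e1, e2] at h1
    set T := ∑ l ∈ S, (θ l : ℝ≥0∞) ^ q.toReal with hT
    have hTt : T ≠ ∞ := ENNReal.sum_ne_top.mpr fun l _ =>
      ENNReal.rpow_ne_top_of_nonneg (by linarith) ENNReal.coe_ne_top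
    rcases eq_or_ne T 0 with h0 | h0
    · rw [h0]; exact zero_le
    have e3 : T = T ^ (1 / q.toReal) * T ^ (1 / q.toReal.conjExponent) := by
      rw [← ENNReal.rpow_add _ _ h0 hTt, one_div, one_div, hconj.inv_add_inv_eq_one,
        ENNReal.rpow_one]
    have e4 : T ^ (1 / q.toReal) ≤ 4 * A := by
      rw [e3] at h1
      have hne : T ^ (1 / q.toReal.conjExponent) ≠ 0 := by
        simp [ENNReal.rpow_eq_zero_iff, h0, hTt]
      have hnt : T ^ (1 / q.toReal.conjExponent) ≠ ∞ :=
        ENNReal.rpow_ne_top_of_nonneg (by have := hconj.symm.pos; positivity) hTt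
      rw [← e3] at h1
      nth_rewrite 1 [e3] at h1
      exact (ENNReal.mul_le_mul_iff_left hne hnt).mp h1
    rwa [one_div, ENNReal.rpow_inv_le_iff (by linarith)] at e4
  rw [hx, seqNorm_const_mul hq0, seqNorm, if_neg hqt]
  have h8 : (8 : ℝ≥0∞) * A = 2 * (4 * A) := by rw [← mul_assoc]; norm_num
  rw [h8]
  gcongr
  rw [one_div, ENNReal.rpow_inv_le_iff (by linarith), ENNReal.tsum_eq_iSup_sum]
  exact iSup_le hS

end Testing

/-! ### The Duhamel estimate -/

theorem Represents.sub {n : ℕ} {T₁ T₂ : 𝓢'(Space n, ℂ)} {f₁ f₂ : Space n → ℂ}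
    (h₁ : Represents T₁ f₁) (h₂ : Represents T₂ f₂) :
    Represents (T₁ - T₂) (fun x => f₁ x - f₂ x) := by
  refine ⟨h₁.1.sub h₂.1, fun ψ => ?_⟩
  obtain ⟨i₁, e₁⟩ := h₁.2 ψ
  obtain ⟨i₂, e₂⟩ := h₂.2 ψ
  simp_rw [sub_mul]
  refine ⟨i₁.sub i₂, ?_⟩
  rw [integral_sub i₁ i₂, ← e₁, ← e₂]
  rfl

theorem seqNorm_nonlinearity_sub_le {n : ℕ} (hn : 0 < n) {b α p p' : ℝ} (hb : 0 < b) (hα : 0 < α)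
    (hpp : 1 / p' = b / n + (α + 1) / p) {q : ℝ≥0∞} (hq : q ≠ 0) :
    ∃ C : ℝ≥0, ∀ (u v : Space n → ℂ) (K : ℝ≥0), seqNorm q (lorentzSeq p u) ≤ K →
      seqNorm q (lorentzSeq p v) ≤ K → seqNorm q (lorentzSeq p (fun x => u x - v x)) ≠ ∞ →
      seqNorm q (lorentzSeq p' (fun x => nonlinearity b α u x - nonlinearity b α v x)) ≤
        C * (K : ℝ≥0∞) ^ α * seqNorm q (lorentzSeq p (fun x => u x - v x)) := by
  obtain ⟨C, hC⟩ := lorentzSeq_nonlinearity_sub_le hn hb hα hpp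
  refine ⟨C, fun u v K hu hv hw => ?_⟩
  rw [← seqNorm_shift 2, ← seqNorm_const_mul hq]
  exact seqNorm_mono (hC u v K (fun m => (le_seqNorm hq m).trans hu)
    (fun m => (le_seqNorm hq m).trans hv) fun m => ne_top_of_le_ne_top hw (le_seqNorm hq m))

/-- For a fixed finite combination of atoms the Duhamel difference is a scalar time integral, to
which the dispersive and Hölder bounds apply at each τ; duality is used once, after integration. The
measurable majorant ρ stands for the norm of the difference, whose measurability in τ is not known.
-/
theorem duhamel_estimate {n : ℕ} (hn : 0 < n) {b α p p' β : ℝ} (hb : 0 < b) (hα : 0 < α)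
    (hp : 2 < p) (hconj : 1 / p + 1 / p' = 1) (hpp : 1 / p' = b / n + (α + 1) / p)
    {q : ℝ≥0∞} (hq : 1 < q) :
    ∃ C : ℝ≥0, ∀ (γ K : ℝ) (φ₁ φ₂ : 𝓢'(Space n, ℂ)) (u v : ℝ → Space n → ℂ),
      (γ = 1 ∨ γ = -1) → 0 ≤ K → IsGlobalSolution b α γ φ₁ u → IsGlobalSolution b α γ φ₂ v →
      (∀ t > 0, seqNorm q (lorentzSeq p (u t)) ≤ ENNReal.ofReal (K * t ^ (-β))) →
      (∀ t > 0, seqNorm q (lorentzSeq p (v t)) ≤ ENNReal.ofReal (K * t ^ (-β))) →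
      ∀ t > 0, ∀ ρ : ℝ → ℝ, Measurable ρ →
        (∀ τ ∈ Ioo 0 t, seqNorm q (lorentzSeq p (fun x => u τ x - v τ x)) ≤
          ENNReal.ofReal (ρ τ)) →
        ∀ f : Space n → ℂ, Represents (schrodingerGroup t (φ₁ - φ₂)) f →
        seqNorm q (lorentzSeq p (fun x => (u t x - v t x) - f x)) ≤
          C * ENNReal.ofReal (K ^ α) * ∫⁻ τ in Ioo 0 t, ENNReal.ofReal
            ((t - τ) ^ (-((n : ℝ) / 2 * (1 / p' - 1 / p))) * τ ^ (-(β * α)) * ρ τ) := by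
  have hq0 : q ≠ 0 := (zero_lt_one.trans hq).ne'
  obtain ⟨C₁, hC₁⟩ := enorm_integral_mul_testFlow_le (n := n) hp hconj hq
  obtain ⟨C₂, hC₂⟩ := seqNorm_nonlinearity_sub_le hn hb hα hpp hq0
  refine ⟨8 * (C₁ * C₂), ?_⟩
  intro γ K φ₁ φ₂ u v hγ hK hu hv hKu hKv t ht ρ hρm hρ f hf
  obtain ⟨U, N₁, hU, hN₁, hsol₁⟩ := hu
  obtain ⟨V, N₂, hV, hN₂, hsol₂⟩ := hv
  set κ : ℝ := (n : ℝ) / 2 * (1 / p' - 1 / p) with hκ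
  set J : ℝ≥0∞ := ∫⁻ τ in Ioo 0 t, ENNReal.ofReal ((t - τ) ^ (-κ) * τ ^ (-(β * α)) * ρ τ) with hJ
  have hg := ((hU t ht).sub (hV t ht)).sub hf
  -- An infinite bound is trivial; otherwise it is a finite constant, as the duality lemma requires.
  rcases eq_or_ne ((C₁ : ℝ≥0∞) * C₂ * ENNReal.ofReal (K ^ α) * J) ∞ with htop | htop
  · have : ((8 * (C₁ * C₂) : ℝ≥0) : ℝ≥0∞) * ENNReal.ofReal (K ^ α) * J = ∞ := by
      push_cast
      rw [mul_assoc 8, mul_assoc 8, htop, ENNReal.mul_top (by norm_num)]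
    rw [this]; exact le_top
  have hmain : ∀ (S : Finset ℤ) (z : ℤ → ℝ≥0) (ψ : ℤ → 𝓢(Space n, ℂ)),
      (∀ l ∈ S, IsDyadicAtom p l (ψ l)) →
      ‖∫ x, ((u t x - v t x) - f x) * (∑ l ∈ S, (z l : ℂ) • ψ l) x‖ₑ ≤
        ((C₁ : ℝ≥0∞) * C₂ * ENNReal.ofReal (K ^ α) * J).toNNReal *
          dualNorm q S (fun l => z l) := by
    intro S z ψ hψ
    rw [ENNReal.coe_toNNReal htop]
    set Ψ : 𝓢(Space n, ℂ) := ∑ l ∈ S, (z l : ℂ) • ψ l with hΨ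
    set D := dualNorm q S (fun l => z l) with hD
    obtain ⟨i₁, e₁⟩ := hsol₁ t ht Ψ
    obtain ⟨i₂, e₂⟩ := hsol₂ t ht Ψ
    have e : ∫ x, ((u t x - v t x) - f x) * Ψ x = Complex.I * (γ : ℂ) * ∫ τ in (0 : ℝ)..t,
        (schrodingerGroup (t - τ) (N₁ τ) Ψ - schrodingerGroup (t - τ) (N₂ τ) Ψ) := by
      rw [← (hg.2 Ψ).2, intervalIntegral.integral_sub i₁ i₂, map_sub]
      change U t Ψ - V t Ψ - (schrodingerGroup t φ₁ Ψ - schrodingerGroup t φ₂ Ψ) = _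
      rw [e₁, e₂]
      ring
    have hunit : ‖Complex.I * (γ : ℂ)‖ₑ = 1 := by
      rw [← ofReal_norm]
      rcases hγ with rfl | rfl <;> simp
    rw [e, enorm_mul, hunit, one_mul, intervalIntegral.integral_of_le ht.le,
      ← restrict_Ioo_eq_restrict_Ioc]
    refine (enorm_integral_le_lintegral_enorm _).trans ?_
    calc _ ≤ ∫⁻ τ in Ioo 0 t, (C₁ * C₂ * ENNReal.ofReal (K ^ α) * D) *
          ENNReal.ofReal ((t - τ) ^ (-κ) * τ ^ (-(β * α)) * ρ τ) := by
          refine setLIntegral_mono' measurableSet_Ioo fun τ hτ => ?_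
          have hτ0 : 0 < τ := hτ.1
          have hs : 0 < t - τ := sub_pos.mpr hτ.2
          have hN := (hN₁ τ hτ0).sub (hN₂ τ hτ0)
          have eN : schrodingerGroup (t - τ) (N₁ τ) Ψ - schrodingerGroup (t - τ) (N₂ τ) Ψ =
              ∫ x, (nonlinearity b α (u τ) x - nonlinearity b α (v τ) x) *
                testFlow (t - τ) Ψ x := by
            rw [schrodingerGroup_apply, schrodingerGroup_apply, ← (hN.2 _).2]
            rfl
          rw [eN]
          have hNle := hC₂ (u τ) (v τ) (K * τ ^ (-β)).toNNReal (hKu τ hτ0) (hKv τ hτ0)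
            (ne_top_of_le_ne_top ENNReal.ofReal_ne_top (hρ τ hτ))
          have hNle' : seqNorm q (lorentzSeq p'
              (fun x => nonlinearity b α (u τ) x - nonlinearity b α (v τ) x)) ≤
              C₂ * ENNReal.ofReal (K ^ α) * ENNReal.ofReal (τ ^ (-(β * α))) *
                ENNReal.ofReal (ρ τ) := by
            refine hNle.trans ?_
            have : (((K * τ ^ (-β)).toNNReal : ℝ≥0∞)) ^ α =
                ENNReal.ofReal (K ^ α) * ENNReal.ofReal (τ ^ (-(β * α))) := by
              change ENNReal.ofReal (K * τ ^ (-β)) ^ α = _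
              rw [ENNReal.ofReal_rpow_of_nonneg (by positivity) hα.le,
                Real.mul_rpow hK (by positivity), ← Real.rpow_mul hτ0.le,
                ENNReal.ofReal_mul (by positivity), neg_mul]
            rw [this, ← mul_assoc]
            gcongr
            exact hρ τ hτ
          have hNfin : seqNorm q (lorentzSeq p'
              (fun x => nonlinearity b α (u τ) x - nonlinearity b α (v τ) x)) ≠ ∞ := by
            refine ne_top_of_le_ne_top ?_ hNle'
            exact ENNReal.mul_ne_top (ENNReal.mul_ne_top (ENNReal.mul_ne_top ENNReal.coe_ne_top
              ENNReal.ofReal_ne_top) ENNReal.ofReal_ne_top) ENNReal.ofReal_ne_top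
          refine (hC₁ _ (t - τ) hN.1 hs hNfin S z ψ hψ).trans ?_
          rw [← hD, ENNReal.ofReal_mul (by positivity), ENNReal.ofReal_mul (by positivity)]
          calc _ ≤ C₁ * ENNReal.ofReal ((t - τ) ^ (-κ)) * (D * (C₂ * ENNReal.ofReal (K ^ α) *
                ENNReal.ofReal (τ ^ (-(β * α))) * ENNReal.ofReal (ρ τ))) := by gcongr
            _ = _ := by ring
      _ = _ := by
          rw [lintegral_const_mul _ (by fun_prop)]
          ring
  have := seqNorm_le_of_forall_pairing (p := p) (fun ψ => (hg.2 ψ).1) hq hmain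
  rw [ENNReal.coe_toNNReal htop] at this
  refine this.trans (le_of_eq ?_)
  push_cast
  ring

/-! ### Decay from a singular integral inequality -/

section Bootstrap

variable {κ a β h : ℝ}

/-- The substitution τ = ts; by κ + a = 1 all powers of t cancel. -/
theorem ofReal_rpow_mul_setLIntegral_eq (hκ : κ + a = 1) {t c : ℝ} (ht : 0 < t) (hc : c ≤ 1) :
    ENNReal.ofReal (t ^ (β + h)) * ∫⁻ τ in Ioo 0 (t * c),
        ENNReal.ofReal ((t - τ) ^ (-κ) * τ ^ (-a) * τ ^ (-(β + h))) =
      ∫⁻ s in Ioo 0 c, ENNReal.ofReal ((1 - s) ^ (-κ) * s ^ (-(a + β + h))) := by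
  have himg : Ioo 0 (t * c) = (fun s => t * s) '' Ioo 0 c := by
    rw [image_mul_left_Ioo ht, mul_zero]
  rw [himg, lintegral_image_eq_lintegral_abs_deriv_mul measurableSet_Ioo (f' := fun _ => t)
    (fun x _ => by simpa using ((hasDerivAt_id x).const_mul t).hasDerivWithinAt)
    (fun x _ y _ hxy => mul_left_cancel₀ ht.ne' hxy),
    ← lintegral_const_mul' _ _ ENNReal.ofReal_ne_top]
  refine setLIntegral_congr_fun measurableSet_Ioo fun s hs => ?_
  have hs1 : 0 ≤ 1 - s := by linarith [hs.2]
  rw [abs_of_pos ht, ← ENNReal.ofReal_mul ht.le, ← ENNReal.ofReal_mul (by positivity)]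
  congr 1
  have e1 : t - t * s = t * (1 - s) := by ring
  rw [e1, Real.mul_rpow ht.le hs1, Real.mul_rpow ht.le hs.1.le, Real.mul_rpow ht.le hs.1.le]
  have e2 : s ^ (-(a + β + h)) = s ^ (-a) * s ^ (-(β + h)) := by
    rw [← Real.rpow_add hs.1]; congr 1; ring
  have e3 : t ^ (β + h) * t * t ^ (-κ) * t ^ (-a) * t ^ (-(β + h)) = 1 := by
    nth_rewrite 2 [← Real.rpow_one t]
    rw [← Real.rpow_add ht, ← Real.rpow_add ht, ← Real.rpow_add ht, ← Real.rpow_add ht,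
      show β + h + 1 + -κ + -a + -(β + h) = 0 by linarith, Real.rpow_zero]
  rw [e2]
  linear_combination ((1 - s) ^ (-κ) * s ^ (-a) * s ^ (-(β + h))) * e3

theorem lintegral_eq_ofReal_betaFun {μ ν : ℝ} (hμ : 0 < μ) (hν : 0 < ν) :
    ∫⁻ s in Ioo (0 : ℝ) 1, ENNReal.ofReal ((1 - s) ^ (μ - 1) * s ^ (ν - 1)) =
      ENNReal.ofReal (betaFun μ ν) := by
  have hint : IntegrableOn (fun s : ℝ => (1 - s) ^ (μ - 1) * s ^ (ν - 1)) (Ioo 0 1) := by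
    have h1 := (Complex.betaIntegral_convergent (u := (ν : ℂ)) (v := (μ : ℂ)) (by simpa) (by simpa))
    rw [intervalIntegrable_iff_integrableOn_Ioo_of_le zero_le_one] at h1
    refine IntegrableOn.congr_fun h1.norm (fun s hs => ?_) measurableSet_Ioo
    have hs1 : 0 < 1 - s := by linarith [hs.2]
    have e : (1 - (s : ℂ)) = ((1 - s : ℝ) : ℂ) := by push_cast; ring
    rw [norm_mul, e, Complex.norm_cpow_eq_rpow_re_of_pos hs.1,
      Complex.norm_cpow_eq_rpow_re_of_pos hs1]
    simp [mul_comm]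
  rw [betaFun, intervalIntegral.integral_of_le zero_le_one, ← restrict_Ioo_eq_restrict_Ioc,
    ofReal_integral_eq_lintegral_ofReal hint]
  filter_upwards [self_mem_ae_restrict measurableSet_Ioo] with s hs
  have hs1 : 0 < 1 - s := by linarith [hs.2]
  have hs0 : 0 < s := hs.1
  positivity

theorem ofReal_rpow_mul_le_iff {t H : ℝ} (ht : 0 < t) {X : ℝ≥0∞} (θ : ℝ) :
    ENNReal.ofReal (t ^ θ) * X ≤ ENNReal.ofReal H ↔ X ≤ ENNReal.ofReal (H * t ^ (-θ)) := by
  have e1 : ENNReal.ofReal (t ^ θ) * ENNReal.ofReal (t ^ (-θ)) = 1 := by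
    rw [← ENNReal.ofReal_mul (by positivity), ← Real.rpow_add ht]; simp
  have h0 : ENNReal.ofReal (t ^ θ) ≠ 0 := by simp; positivity
  rw [ENNReal.ofReal_mul' (by positivity)]
  constructor
  · intro hX
    calc X = ENNReal.ofReal (t ^ θ) * X * ENNReal.ofReal (t ^ (-θ)) := by
          rw [mul_right_comm, e1, one_mul]
      _ ≤ _ := by gcongr
  · intro hX
    calc _ ≤ ENNReal.ofReal (t ^ θ) * (ENNReal.ofReal H * ENNReal.ofReal (t ^ (-θ))) := by gcongr
      _ = _ := by rw [mul_left_comm, e1, mul_one]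

variable {X lin : ℝ → ℝ≥0∞} {E D : ℝ}

/-- The singular integral inequality satisfied by the norm of the difference of two solutions. -/
def IsSubsolution (κ a E : ℝ) (X lin : ℝ → ℝ≥0∞) : Prop :=
  ∀ t > 0, ∀ ρ : ℝ → ℝ, Measurable ρ → (∀ τ ∈ Ioo 0 t, X τ ≤ ENNReal.ofReal (ρ τ)) →
    X t ≤ lin t + ENNReal.ofReal E *
      ∫⁻ τ in Ioo 0 t, ENNReal.ofReal ((t - τ) ^ (-κ) * τ ^ (-a) * ρ τ)

theorem IsSubsolution.mul_le (hX : IsSubsolution κ a E X lin) (hκ : κ + a = 1)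
    {t : ℝ} (ht : 0 < t) {H : ℝ} (hH : 0 ≤ H)
    (hle : ∀ τ ∈ Ioo 0 t, ENNReal.ofReal (τ ^ (β + h)) * X τ ≤ ENNReal.ofReal H) :
    ENNReal.ofReal (t ^ (β + h)) * X t ≤ ENNReal.ofReal (t ^ (β + h)) * lin t +
      ENNReal.ofReal E * (ENNReal.ofReal H *
        ∫⁻ s in Ioo 0 1, ENNReal.ofReal ((1 - s) ^ (-κ) * s ^ (-(a + β + h)))) := by
  have h1 := hX t ht (fun τ => H * τ ^ (-(β + h))) (by fun_prop)
    (fun τ hτ => (ofReal_rpow_mul_le_iff hτ.1 _).mp (hle τ hτ))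
  refine (mul_le_mul' le_rfl h1).trans (le_of_eq ?_)
  rw [mul_add, ← ofReal_rpow_mul_setLIntegral_eq hκ ht le_rfl, mul_one]
  congr 1
  have e : ∀ τ : ℝ, ENNReal.ofReal ((t - τ) ^ (-κ) * τ ^ (-a) * (H * τ ^ (-(β + h)))) =
      ENNReal.ofReal H * ENNReal.ofReal ((t - τ) ^ (-κ) * τ ^ (-a) * τ ^ (-(β + h))) := by
    intro τ
    rw [← ENNReal.ofReal_mul hH]; congr 1; ring
  simp_rw [e]
  rw [lintegral_const_mul' _ _ ENNReal.ofReal_ne_top]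
  ring

/-- Times before T carry the crude bound H₀, later ones the improved bound H. After rescaling, the
early times occupy (0, T/t), which shrinks as t grows. -/
theorem IsSubsolution.mul_le_of_split (hX : IsSubsolution κ a E X lin) (hκ : κ + a = 1)
    {t T : ℝ} (hT : 0 < T) (hTt : T ≤ t) {H H₀ : ℝ} (hH : 0 ≤ H) (hH₀ : 0 ≤ H₀)
    (hle₀ : ∀ τ > 0, ENNReal.ofReal (τ ^ (β + h)) * X τ ≤ ENNReal.ofReal H₀)
    (hle : ∀ τ ≥ T, ENNReal.ofReal (τ ^ (β + h)) * X τ ≤ ENNReal.ofReal H) :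
    ENNReal.ofReal (t ^ (β + h)) * X t ≤ ENNReal.ofReal (t ^ (β + h)) * lin t +
      ENNReal.ofReal E * (ENNReal.ofReal H *
        (∫⁻ s in Ioo 0 1, ENNReal.ofReal ((1 - s) ^ (-κ) * s ^ (-(a + β + h)))) +
        ENNReal.ofReal H₀ * ∫⁻ s in Ioo 0 (T / t),
          ENNReal.ofReal ((1 - s) ^ (-κ) * s ^ (-(a + β + h)))) := by
  have ht : 0 < t := hT.trans_le hTt
  have h1 := hX t ht (fun τ => H * τ ^ (-(β + h)) + (Iio T).indicator
      (fun τ => H₀ * τ ^ (-(β + h))) τ)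
    ((by fun_prop : Measurable fun τ : ℝ => H * τ ^ (-(β + h))).add
      ((by fun_prop : Measurable fun τ : ℝ => H₀ * τ ^ (-(β + h))).indicator measurableSet_Iio))
    (fun τ hτ => by
      have hτ0 : 0 < τ := hτ.1
      rcases lt_or_ge τ T with hlt | hge
      · refine ((ofReal_rpow_mul_le_iff hτ.1 _).mp (hle₀ τ hτ.1)).trans ?_
        rw [indicator_of_mem (mem_Iio.mpr hlt)]
        apply ENNReal.ofReal_le_ofReal
        have : 0 ≤ H * τ ^ (-(β + h)) := by positivity
        linarith
      · refine ((ofReal_rpow_mul_le_iff hτ.1 _).mp (hle τ hge)).trans ?_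
        rw [indicator_of_notMem (by simpa using hge), add_zero])
  refine (mul_le_mul' le_rfl h1).trans ?_
  rw [mul_add, ← ofReal_rpow_mul_setLIntegral_eq hκ ht le_rfl, mul_one,
    ← ofReal_rpow_mul_setLIntegral_eq hκ ht ((div_le_one ht).mpr hTt), mul_div_cancel₀ _ ht.ne']
  refine add_le_add le_rfl ?_
  set k : ℝ → ℝ≥0∞ := fun τ =>
    ENNReal.ofReal ((t - τ) ^ (-κ) * τ ^ (-a) * τ ^ (-(β + h))) with hk
  have hint : ∫⁻ τ in Ioo 0 t, ENNReal.ofReal ((t - τ) ^ (-κ) * τ ^ (-a) *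
      (H * τ ^ (-(β + h)) + (Iio T).indicator (fun τ => H₀ * τ ^ (-(β + h))) τ)) ≤
      ENNReal.ofReal H * (∫⁻ τ in Ioo 0 t, k τ) + ENNReal.ofReal H₀ * ∫⁻ τ in Ioo 0 T, k τ := by
    have hkm : Measurable k := by fun_prop
    rw [← lintegral_const_mul _ hkm, ← lintegral_const_mul _ hkm]
    calc _ ≤ ∫⁻ τ in Ioo 0 t, (ENNReal.ofReal H * k τ +
          (Iio T).indicator (fun τ => ENNReal.ofReal H₀ * k τ) τ) := by
          refine setLIntegral_mono' measurableSet_Ioo fun τ hτ => ?_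
          rw [mul_add]
          refine ENNReal.ofReal_add_le.trans (add_le_add (le_of_eq ?_) ?_)
          · rw [hk, ← ENNReal.ofReal_mul hH]
            congr 1; ring
          · by_cases hτT : τ ∈ Iio T
            · rw [indicator_of_mem hτT, indicator_of_mem hτT, hk, ← ENNReal.ofReal_mul hH₀]
              apply le_of_eq
              congr 1; ring
            · rw [indicator_of_notMem hτT, indicator_of_notMem hτT]
              simp
      _ ≤ _ := by
          rw [lintegral_add_left (hkm.const_mul _), setLIntegral_indicator measurableSet_Iio]
          refine add_le_add le_rfl (lintegral_mono_set ?_)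
          exact fun τ hτ => ⟨hτ.2.1, hτ.1⟩
  calc _ ≤ ENNReal.ofReal (t ^ (β + h)) * (ENNReal.ofReal E *
        (ENNReal.ofReal H * (∫⁻ τ in Ioo 0 t, k τ) +
          ENNReal.ofReal H₀ * ∫⁻ τ in Ioo 0 T, k τ)) := by gcongr
    _ = _ := by ring

theorem tendsto_setLIntegral_Ioo_div {f : ℝ → ℝ≥0∞} (hf : ∫⁻ s in Ioo 0 1, f s ≠ ∞) (T : ℝ) :
    Tendsto (fun t : ℝ => ∫⁻ s in Ioo 0 (T / t), f s) atTop (𝓝 0) := by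
  have hdiv : Tendsto (fun t : ℝ => T / t) atTop (𝓝 0) := tendsto_const_nhds.div_atTop tendsto_id
  have hvol : Tendsto ((volume.restrict (Ioo (0 : ℝ) 1)) ∘ fun t : ℝ => Ioo 0 (T / t)) atTop
      (𝓝 0) := by
    have h1 : Tendsto (fun t : ℝ => ENNReal.ofReal (T / t)) atTop (𝓝 0) := by
      simpa using ENNReal.tendsto_ofReal hdiv
    refine tendsto_of_tendsto_of_tendsto_of_le_of_le tendsto_const_nhds h1 (fun _ => zero_le)
      fun t => ?_
    refine (Measure.restrict_apply_le _ _).trans ?_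
    rw [Real.volume_Ioo, sub_zero]
  refine (tendsto_setLIntegral_zero hf hvol).congr' ?_
  filter_upwards [hdiv.eventually_le_const one_pos] with t ht
  rw [Measure.restrict_restrict measurableSet_Ioo,
    inter_eq_left.mpr (Ioo_subset_Ioo_right ht)]

/-- The a priori decay only gives D t^h for the weighted norm, but this makes its supremum S over
(0, T] finite. Then S ≤ c + S/2 with c independent of T, and S/2 can be absorbed. -/
theorem IsSubsolution.exists_forall_mul_le (hX : IsSubsolution κ a E X lin) (hκ : κ + a = 1)
    (hh : 0 ≤ h) (hD : 0 ≤ D) (hXD : ∀ t > 0, X t ≤ ENNReal.ofReal (D * t ^ (-β)))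
    (hE : ENNReal.ofReal E * (∫⁻ s in Ioo 0 1,
      ENNReal.ofReal ((1 - s) ^ (-κ) * s ^ (-(a + β + h)))) ≤ 2⁻¹)
    (hlin : Tendsto (fun t : ℝ => ENNReal.ofReal (t ^ (β + h)) * lin t) atTop (𝓝 0)) :
    ∃ H₀ : ℝ, 0 ≤ H₀ ∧ ∀ t > 0, ENNReal.ofReal (t ^ (β + h)) * X t ≤ ENNReal.ofReal H₀ := by
  set Y : ℝ → ℝ≥0∞ := fun t => ENNReal.ofReal (t ^ (β + h)) * X t with hY
  have hYD : ∀ t > 0, Y t ≤ ENNReal.ofReal (D * t ^ h) := by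
    intro t ht
    refine (ofReal_rpow_mul_le_iff ht _).mpr ((hXD t ht).trans (le_of_eq ?_))
    rw [mul_assoc, ← Real.rpow_add ht]
    congr 3; ring
  obtain ⟨t₁, ht₁⟩ := eventually_atTop.mp (ENNReal.tendsto_nhds_zero.mp hlin 1 one_pos)
  set t₀ := max t₁ 1
  have ht₀ : 0 < t₀ := lt_of_lt_of_le one_pos (le_max_right _ _)
  refine ⟨2 * (D * t₀ ^ h + 1), by positivity, fun T hT => ?_⟩
  set c : ℝ≥0∞ := ENNReal.ofReal (D * t₀ ^ h + 1) with hc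
  set S : ℝ≥0∞ := ⨆ τ ∈ Ioc 0 T, Y τ with hS
  have hSfin : S ≠ ∞ := by
    refine ne_top_of_le_ne_top ENNReal.ofReal_ne_top (b := ENNReal.ofReal (D * T ^ h)) ?_
    refine iSup₂_le fun τ hτ => (hYD τ hτ.1).trans (ENNReal.ofReal_le_ofReal ?_)
    have := hτ.1.le
    have := hτ.2
    gcongr
  have hle : ∀ τ ∈ Ioc 0 T, Y τ ≤ S := fun τ hτ => le_iSup₂ (f := fun τ _ => Y τ) τ hτ
  have hstep : S ≤ c + S / 2 := by
    refine iSup₂_le fun τ hτ => ?_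
    rcases le_total τ t₀ with hlt | hge
    · refine ((hYD τ hτ.1).trans (ENNReal.ofReal_le_ofReal ?_)).trans le_self_add
      have := hτ.1.le
      have : D * τ ^ h ≤ D * t₀ ^ h := by gcongr
      linarith
    · have h1 := hX.mul_le hκ hτ.1 (H := S.toReal) ENNReal.toReal_nonneg (β := β) (h := h)
        (fun σ hσ => by
          rw [ENNReal.ofReal_toReal hSfin]
          exact hle σ ⟨hσ.1, hσ.2.le.trans hτ.2⟩)
      refine h1.trans (add_le_add ?_ ?_)
      · refine (ht₁ τ ((le_max_left _ _).trans hge)).trans ?_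
        rw [hc, ← ENNReal.ofReal_one]
        apply ENNReal.ofReal_le_ofReal
        have : 0 ≤ D * t₀ ^ h := by positivity
        linarith
      · rw [ENNReal.ofReal_toReal hSfin, mul_left_comm, div_eq_mul_inv]
        gcongr
  have hS2 : S / 2 ≤ c := by
    have : S / 2 + S / 2 ≤ c + S / 2 := by rwa [ENNReal.add_halves]
    exact (ENNReal.add_le_add_iff_right (ENNReal.div_ne_top hSfin two_ne_zero)).mp this
  calc Y T ≤ S := hle T ⟨hT, le_rfl⟩
    _ = S / 2 + S / 2 := (ENNReal.add_halves S).symm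
    _ ≤ c + c := add_le_add hS2 hS2
    _ = _ := by rw [hc, ← ENNReal.ofReal_add (by positivity) (by positivity), two_mul]

/-- Each eventual bound H improves to H/8 + H/2 + H/8 = 3H/4: the linear term, the contraction, and
the contribution of early times. Iteration gives the limit zero. -/
theorem IsSubsolution.tendsto_zero (hX : IsSubsolution κ a E X lin) (hκ : κ + a = 1)
    (hh : 0 ≤ h) (hD : 0 ≤ D) (hXD : ∀ t > 0, X t ≤ ENNReal.ofReal (D * t ^ (-β)))
    (hfin : ∫⁻ s in Ioo 0 1, ENNReal.ofReal ((1 - s) ^ (-κ) * s ^ (-(a + β + h))) ≠ ∞)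
    (hE : ENNReal.ofReal E * (∫⁻ s in Ioo 0 1,
      ENNReal.ofReal ((1 - s) ^ (-κ) * s ^ (-(a + β + h)))) ≤ 2⁻¹)
    (hlin : Tendsto (fun t : ℝ => ENNReal.ofReal (t ^ (β + h)) * lin t) atTop (𝓝 0)) :
    Tendsto (fun t : ℝ => ENNReal.ofReal (t ^ (β + h)) * X t) atTop (𝓝 0) := by
  obtain ⟨H₁, hH₁, hle₁⟩ := hX.exists_forall_mul_le hκ hh hD hXD hE hlin
  obtain ⟨H₀, hH₀, hle₀⟩ : ∃ H₀ : ℝ, 0 < H₀ ∧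
      ∀ t > 0, ENNReal.ofReal (t ^ (β + h)) * X t ≤ ENNReal.ofReal H₀ :=
    ⟨H₁ + 1, by linarith, fun t ht =>
      (hle₁ t ht).trans (ENNReal.ofReal_le_ofReal (by linarith))⟩
  have hiter : ∀ k : ℕ, ∀ᶠ t : ℝ in atTop,
      ENNReal.ofReal (t ^ (β + h)) * X t ≤ ENNReal.ofReal (H₀ * (3 / 4) ^ k) := by
    intro k
    induction k with
    | zero =>
      filter_upwards [eventually_gt_atTop 0] with t ht
      simpa using hle₀ t ht
    | succ k ih =>
      set H : ℝ := H₀ * (3 / 4) ^ k with hH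
      have hHpos : 0 < H := by positivity
      have h8 : (0 : ℝ≥0∞) < ENNReal.ofReal (H / 8) := by simp; positivity
      obtain ⟨T₁, hT₁⟩ := eventually_atTop.mp ih
      set T := max T₁ 1
      have hT : 0 < T := lt_of_lt_of_le one_pos (le_max_right _ _)
      have hsmall := ENNReal.Tendsto.const_mul (a := ENNReal.ofReal E * ENNReal.ofReal H₀)
        (tendsto_setLIntegral_Ioo_div hfin T)
        (Or.inr (ENNReal.mul_ne_top ENNReal.ofReal_ne_top ENNReal.ofReal_ne_top))
      rw [mul_zero] at hsmall
      filter_upwards [eventually_ge_atTop T, hlin.eventually_le_const h8,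
        hsmall.eventually_le_const h8] with t ht h1 h2
      refine (hX.mul_le_of_split hκ hT ht hHpos.le hH₀.le hle₀
        (fun τ hτ => hT₁ τ ((le_max_left _ _).trans hτ))).trans ?_
      have e : H₀ * (3 / 4) ^ (k + 1) = H / 8 + (H * 2⁻¹ + H / 8) := by rw [hH]; ring
      rw [e, ENNReal.ofReal_add (by positivity) (by positivity),
        ENNReal.ofReal_add (by positivity) (by positivity), mul_add]
      refine add_le_add h1 (add_le_add ?_ ?_)
      · rw [mul_left_comm, ENNReal.ofReal_mul hHpos.le]
        refine mul_le_mul' le_rfl (hE.trans (le_of_eq ?_))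
        rw [ENNReal.ofReal_inv_of_pos two_pos]
        simp
      · rw [← mul_assoc]; exact h2
  rw [ENNReal.tendsto_nhds_zero]
  intro ε hε
  have hpow : Tendsto (fun k : ℕ => ENNReal.ofReal (H₀ * (3 / 4) ^ k)) atTop (𝓝 0) := by
    have : Tendsto (fun k : ℕ => H₀ * (3 / 4 : ℝ) ^ k) atTop (𝓝 (H₀ * 0)) :=
      (tendsto_pow_atTop_nhds_zero_of_lt_one (by norm_num) (by norm_num)).const_mul H₀
    simpa using ENNReal.tendsto_ofReal this
  obtain ⟨k, hk⟩ := (hpow.eventually_le_const hε).exists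
  exact (hiter k).mono fun t ht => ht.trans hk

end Bootstrap

/-! ### Parameters and conclusion -/

section Parameters

variable {n : ℕ} {b α : ℝ}

theorem two_lt_rExp (hb : 0 < b) (hbn : b < n) (hα : 0 < α) : 2 < rExp n b α := by
  rw [rExp, lt_div_iff₀ (by linarith)]
  have : (0 : ℝ) < n := hb.trans hbn
  nlinarith [mul_pos this hα]

theorem one_div_rExp_add_conjExponent (hb : 0 < b) (hbn : b < n) (hα : 0 < α) :
    1 / rExp n b α + 1 / (rExp n b α).conjExponent = 1 := by
  have h := (Real.HolderConjugate.conjExponent (p := rExp n b α)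
    (by linarith [two_lt_rExp hb hbn hα])).inv_add_inv_eq_one
  rwa [one_div, one_div]

theorem one_div_conjExponent_rExp (hb : 0 < b) (hbn : b < n) (hα : 0 < α) :
    1 / (rExp n b α).conjExponent = b / n + (α + 1) / rExp n b α := by
  have h := one_div_rExp_add_conjExponent hb hbn hα
  have hn : (n : ℝ) ≠ 0 := (hb.trans hbn).ne'
  have hnb : (n : ℝ) - b ≠ 0 := by linarith
  have hα2 : α + 2 ≠ 0 := by linarith
  have : 1 / (rExp n b α).conjExponent = 1 - 1 / rExp n b α := by linarith
  rw [this, rExp]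
  field_simp
  ring

theorem betaExp_pos (hb2 : b < 2) (hα : 0 < α)
    (hα' : 3 ≤ n → α < (4 - 2 * b) / (n - 2)) : 0 < betaExp n b α := by
  rw [betaExp]
  apply div_pos _ (by positivity)
  rcases le_or_gt 3 n with h3 | h3
  · have h3' : (3 : ℝ) ≤ n := by exact_mod_cast h3
    have := (lt_div_iff₀ (by linarith)).mp (hα' h3)
    linarith
  · have h2 : (n : ℝ) ≤ 2 := by exact_mod_cast Nat.lt_succ_iff.mp h3
    nlinarith

/-- Criticality of the scaling: this is what makes the weighted integral inequality invariant under
dilation of time. -/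
theorem half_mul_add_betaExp_mul_eq_one (hb : 0 < b) (hbn : b < n) (hα : 0 < α) :
    (n : ℝ) / 2 * (1 / (rExp n b α).conjExponent - 1 / rExp n b α) + betaExp n b α * α = 1 := by
  have h := one_div_rExp_add_conjExponent hb hbn hα
  have hn : (n : ℝ) ≠ 0 := (hb.trans hbn).ne'
  have hnb : (n : ℝ) - b ≠ 0 := by linarith
  have hα2 : α + 2 ≠ 0 := by linarith
  have : 1 / (rExp n b α).conjExponent = 1 - 1 / rExp n b α := by linarith
  rw [this, rExp, betaExp]
  field_simp
  ring

end Parameters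

theorem exists_lorentz_duhamel_estimate {n : ℕ} {b α : ℝ} (hb : 0 < b) (hbn : b < n) (hα : 0 < α)
    {q : ℝ≥0∞} (hq : 1 < q) (β : ℝ) :
    ∃ C₁ C₂ C₃ : ℝ≥0, ∀ (γ M : ℝ) (φ₁ φ₂ : 𝓢'(Space n, ℂ)) (u v : ℝ → Space n → ℂ),
      (γ = 1 ∨ γ = -1) → 0 ≤ M → IsGlobalSolution b α γ φ₁ u → IsGlobalSolution b α γ φ₂ v →
      (∀ t > 0, ENNReal.ofReal (t ^ β) * lorentzNorm (rExp n b α) q (u t) ≤ ENNReal.ofReal M) →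
      (∀ t > 0, ENNReal.ofReal (t ^ β) * lorentzNorm (rExp n b α) q (v t) ≤ ENNReal.ofReal M) →
      (∀ t > 0, seqNorm q (lorentzSeq (rExp n b α) (fun x => u t x - v t x)) ≤
        ENNReal.ofReal (C₁ * M * t ^ (-β))) ∧
      IsSubsolution ((n : ℝ) / 2 * (1 / (rExp n b α).conjExponent - 1 / rExp n b α)) (β * α)
        (C₂ * M ^ α) (fun t => seqNorm q (lorentzSeq (rExp n b α) (fun x => u t x - v t x)))
        (fun t => C₃ * lorentzNormDist (rExp n b α) q (schrodingerGroup t (φ₁ - φ₂))) := by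
  set p := rExp n b α with hp
  have hn : 0 < n := by exact_mod_cast hb.trans hbn
  have hp2 : 2 < p := two_lt_rExp hb hbn hα
  have hp0 : 0 < p := by linarith
  have hq0 : q ≠ 0 := (zero_lt_one.trans hq).ne'
  obtain ⟨C, hC⟩ := seqNorm_le_lorentzNorm (n := n) hp0 hq0
  obtain ⟨C', hC'⟩ := duhamel_estimate hn hb hα hp2 (one_div_rExp_add_conjExponent hb hbn hα)
    (one_div_conjExponent_rExp hb hbn hα) hq (β := β)
  -- C + 1 keeps the third constant nonzero, so that its product with an infinite norm is ∞ and not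
  -- 0 when the linear evolution is not a function.
  refine ⟨2 ^ (1 / p) * (4 * C), 2 ^ (1 / p) * (2 * C') * C ^ α, 2 ^ (1 / p) * (2 * (C + 1)), ?_⟩
  intro γ M φ₁ φ₂ u v hγ hM hu hv hMu hMv
  have hdecay : ∀ {w : ℝ → Space n → ℂ},
      (∀ t > 0, ENNReal.ofReal (t ^ β) * lorentzNorm p q (w t) ≤ ENNReal.ofReal M) →
      ∀ t > 0, seqNorm q (lorentzSeq p (w t)) ≤ ENNReal.ofReal (C * M * t ^ (-β)) := by
    intro w hw t ht
    refine (hC (w t)).trans ?_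
    rw [mul_assoc, ENNReal.ofReal_mul (NNReal.coe_nonneg C), ENNReal.ofReal_coe_nnreal]
    exact mul_le_mul' le_rfl ((ofReal_rpow_mul_le_iff ht β).mp (hw t ht))
  have h2 : ((2 ^ (1 / p) : ℝ≥0) : ℝ≥0∞) = 2 ^ (1 / p) := by
    rw [ENNReal.coe_rpow_of_ne_zero two_ne_zero, ENNReal.coe_ofNat]
  have hCp : 0 ≤ (C : ℝ) := C.2
  refine ⟨fun t ht => ?_, fun t ht ρ hρm hρ => ?_⟩
  · have h := seqNorm_lorentzSeq_add_le (f := u t) (g := fun x => -v t x) (p := p) hq.le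
    rw [lorentzSeq_neg] at h
    simp_rw [← sub_eq_add_neg] at h
    refine h.trans ?_
    calc _ ≤ 2 ^ (1 / p) * (2 * (ENNReal.ofReal (C * M * t ^ (-β)) +
          ENNReal.ofReal (C * M * t ^ (-β)))) := by
          gcongr
          · exact hdecay hMu t ht
          · exact hdecay hMv t ht
      _ = _ := by
          rw [← h2, ← two_mul, ← ENNReal.ofReal_coe_nnreal, ← ENNReal.ofReal_ofNat 2,
            ← ENNReal.ofReal_mul two_pos.le, ← ENNReal.ofReal_mul two_pos.le,
            ← ENNReal.ofReal_mul (NNReal.coe_nonneg _)]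
          congr 1
          push_cast
          ring
  · set κ := (n : ℝ) / 2 * (1 / p.conjExponent - 1 / p)
    set J : ℝ≥0∞ := ∫⁻ τ in Ioo 0 t, ENNReal.ofReal ((t - τ) ^ (-κ) * τ ^ (-(β * α)) * ρ τ)
    have key : ∀ f : Space n → ℂ, Represents (schrodingerGroup t (φ₁ - φ₂)) f →
        seqNorm q (lorentzSeq p (fun x => u t x - v t x)) ≤
          ((2 ^ (1 / p) * (2 * (C + 1)) : ℝ≥0) : ℝ≥0∞) * lorentzNorm p q f +
            ENNReal.ofReal (((2 ^ (1 / p) * (2 * C') * C ^ α : ℝ≥0) : ℝ) * M ^ α) * J := by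
      intro f hf
      have h1 := hC' γ (C * M) φ₁ φ₂ u v hγ (by positivity) hu hv (hdecay hMu) (hdecay hMv) t ht ρ
        hρm hρ f hf
      -- Split the difference as its linear evolution f plus the Duhamel part.
      have h := seqNorm_lorentzSeq_add_le (f := f) (g := fun x => (u t x - v t x) - f x) (p := p)
        hq.le
      simp only [add_sub_cancel] at h
      refine h.trans ?_
      calc _ ≤ 2 ^ (1 / p) * (2 * ((C + 1) * lorentzNorm p q f +
            C' * ENNReal.ofReal ((C * M) ^ α) * J)) := by
            gcongr
            exact (hC f).trans (mul_le_mul' le_self_add le_rfl)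
        _ = _ := by
            rw [ENNReal.ofReal_mul (NNReal.coe_nonneg _), ENNReal.ofReal_coe_nnreal,
              Real.mul_rpow hCp hM, ENNReal.ofReal_mul (by positivity), ← NNReal.coe_rpow,
              ENNReal.ofReal_coe_nnreal]
            push_cast
            rw [h2]
            ring
    beta_reduce
    rcases isEmpty_or_nonempty {f : Space n → ℂ // Represents (schrodingerGroup t (φ₁ - φ₂)) f}
      with hemp | hne
    · have : lorentzNormDist p q (schrodingerGroup t (φ₁ - φ₂)) = ∞ := by
        rw [lorentzNormDist]
        simp only [iInf_eq_top]
        intro f hf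
        exact (hemp.false ⟨f, hf⟩).elim
      rw [this, ENNReal.mul_top (by simp), top_add]
      exact le_top
    · rw [lorentzNormDist, iInf_subtype', ENNReal.mul_iInf (fun h => absurd h ENNReal.coe_ne_top),
        ENNReal.iInf_add]
      exact le_iInf fun f => key f.1 f.2

end INLS

theorem theorem1p5 (n : ℕ) (b α α₀ : ℝ) (q : ℝ≥0∞)
    (hb : 0 < b) (hb2 : b < 2) (hbn : b < n)
    (hα₀ : 0 < α₀) (hroot : n * α₀ ^ 2 + (n - 2 + 2 * b) * α₀ - 4 + 2 * b = 0)
    (hα : α₀ < α) (hα' : 3 ≤ n → α < (4 - 2 * b) / (n - 2))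
    (hq : ENNReal.ofReal (INLS.rExp n b α) < q) :
    ∃ δ > 0, ∀ (γ h M : ℝ), (γ = 1 ∨ γ = -1) →
      0 ≤ h → h < 1 - INLS.betaExp n b α * (α + 1) → 0 < M →
      (2 * M) ^ α *
        INLS.betaFun
          (1 - n / 2 * (1 / (INLS.rExp n b α).conjExponent - 1 / INLS.rExp n b α))
          (1 - INLS.betaExp n b α * (α + 1) - h) ≤ δ →
      ∀ (φ₁ φ₂ : 𝓢'(INLS.Space n, ℂ)) (u v : ℝ → INLS.Space n → ℂ),
        Tendsto (fun t : ℝ => ENNReal.ofReal (t ^ (INLS.betaExp n b α + h)) *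
            INLS.lorentzNormDist (INLS.rExp n b α) q (INLS.schrodingerGroup t (φ₁ - φ₂)))
          atTop (𝓝 0) →
        INLS.IsGlobalSolution b α γ φ₁ u → INLS.IsGlobalSolution b α γ φ₂ v →
        (∀ t > 0, ENNReal.ofReal (t ^ INLS.betaExp n b α) *
            INLS.lorentzNorm (INLS.rExp n b α) q (u t) ≤ ENNReal.ofReal M) →
        (∀ t > 0, ENNReal.ofReal (t ^ INLS.betaExp n b α) *
            INLS.lorentzNorm (INLS.rExp n b α) q (v t) ≤ ENNReal.ofReal M) →
        Tendsto (fun t : ℝ => ENNReal.ofReal (t ^ (INLS.betaExp n b α + h)) *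
            INLS.lorentzNorm (INLS.rExp n b α) q (fun x => u t x - v t x))
          atTop (𝓝 0) := by
  have hα0 : 0 < α := hα₀.trans hα
  have hr2 := INLS.two_lt_rExp hb hbn hα0
  have hq1 : 1 < q := by
    refine lt_trans ?_ hq
    rw [← ENNReal.ofReal_one]
    exact (ENNReal.ofReal_lt_ofReal_iff (by linarith)).mpr (by linarith)
  have hβ := INLS.betaExp_pos hb2 hα0 hα'
  have hκ := INLS.half_mul_add_betaExp_mul_eq_one hb hbn hα0
  set p := INLS.rExp n b α
  set β := INLS.betaExp n b α
  set κ : ℝ := (n : ℝ) / 2 * (1 / p.conjExponent - 1 / p)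
  obtain ⟨C₁, C₂, C₃, hC⟩ := INLS.exists_lorentz_duhamel_estimate hb hbn hα0 hq1 β
  -- Chosen so that C₂ M^α B ≤ 1/2, using M ≤ 2M. C₂ was fixed before γ, h and M, so δ does not
  -- depend on them.
  refine ⟨1 / (2 * (C₂ + 1)), by positivity, ?_⟩
  intro γ h M hγ hh hh1 hM hδ φ₁ φ₂ u v hlin hu hv hMu hMv
  obtain ⟨hdecay, hsub⟩ := hC γ M φ₁ φ₂ u v hγ hM.le hu hv hMu hMv
  have hG : ∫⁻ s in Ioo (0 : ℝ) 1, ENNReal.ofReal ((1 - s) ^ (-κ) * s ^ (-(β * α + β + h))) =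
      ENNReal.ofReal (INLS.betaFun (1 - κ) (1 - β * (α + 1) - h)) := by
    -- Both Beta parameters are positive: 1 - κ = βα, and the other by the bound on h.
    rw [← INLS.lintegral_eq_ofReal_betaFun (by nlinarith [mul_pos hβ hα0]) (by linarith)]
    congr 1 with s
    congr 3 <;> ring
  have hE : ENNReal.ofReal (C₂ * M ^ α) * (∫⁻ s in Ioo (0 : ℝ) 1,
      ENNReal.ofReal ((1 - s) ^ (-κ) * s ^ (-(β * α + β + h)))) ≤ 2⁻¹ := by
    rw [hG, ← ENNReal.ofReal_mul (by positivity)]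
    have e : (2 : ℝ≥0∞)⁻¹ = ENNReal.ofReal 2⁻¹ := by
      rw [ENNReal.ofReal_inv_of_pos two_pos]; simp
    rw [e]
    apply ENNReal.ofReal_le_ofReal
    have hB0 : 0 ≤ INLS.betaFun (1 - κ) (1 - β * (α + 1) - h) := by
      rw [INLS.betaFun]
      refine intervalIntegral.integral_nonneg zero_le_one fun s hs => ?_
      have := sub_nonneg.mpr hs.2
      have := hs.1
      positivity
    have hMM : M ^ α ≤ (2 * M) ^ α := by gcongr; linarith
    have hC2 : (0 : ℝ) ≤ C₂ := C₂.2
    rw [le_div_iff₀ (by positivity)] at hδ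
    have h1 := mul_le_mul_of_nonneg_right hMM hB0
    have h2 : 0 ≤ M ^ α * INLS.betaFun (1 - κ) (1 - β * (α + 1) - h) := by positivity
    nlinarith
  have hlin' : Tendsto (fun t : ℝ => ENNReal.ofReal (t ^ (β + h)) *
      (C₃ * INLS.lorentzNormDist p q (INLS.schrodingerGroup t (φ₁ - φ₂)))) atTop (𝓝 0) := by
    have := ENNReal.Tendsto.const_mul hlin (Or.inr (ENNReal.coe_ne_top (r := C₃)))
    rw [mul_zero] at this
    refine this.congr fun t => ?_
    ring
  have hfin := hsub.tendsto_zero hκ hh (D := C₁ * M) (by positivity) hdecay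
    (by rw [hG]; exact ENNReal.ofReal_ne_top) hE hlin'
  obtain ⟨C, hC'⟩ := INLS.lorentzNorm_le_seqNorm (n := n) (p := p) (q := q) (by linarith)
    (zero_lt_one.trans hq1).ne'
  have hfin' := ENNReal.Tendsto.const_mul hfin (Or.inr (ENNReal.coe_ne_top (r := C)))
  rw [mul_zero] at hfin'
  refine tendsto_of_tendsto_of_tendsto_of_le_of_le tendsto_const_nhds hfin' (fun _ => zero_le)
    fun t => ?_
  refine (mul_le_mul' le_rfl (hC' _)).trans (le_of_eq ?_)
  ring
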